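/- **Conventions.** A *doctrine* is a functor $P:\mathcal C^{op}\to\mathbf{PreOrd}$. A *morphism* of doctrines $(F,a):P\to Q$ is a functor $F:\mathcal C\to\mathcal D$ with a natural transformation $a:P\to Q\circ F^{op}$; a *2-cell* $(F,a)\Rightarrow(F',a')$ is a natural transformation $\alpha:F\to F'$ with $a_c(x)\le Q(\alpha_c)(a'_c(x))$ for all $x\in P(c)$. This is the 2-category $\mathbf{Doc}$. $\mathcal C\rtimes P$ is the category of pairs $(c,x)$, $x\in P(c)$, an arrow $(c,x)\to(d,y)$ being an arrow $f:c\to d$ with $x\le P(f)(y)$. For Grothendieck topologies $J$ on $\mathcal C\rtimes P$ and $K$ on $\mathcal D\rtimes Q$, $(F,a)$ is a *morphism of doctrinal sites* $(P,J)\to(Q,K)$ if $F$ is flat (a morphism of sites for the trivial topologies) and $F\rtimes a:(\mathcal C\rtimes P,J)\to(\mathcal D\rtimes Q,K)$ is a morphism of sites; $(F,a)$ is *flat* if it is so for the trivial topologies. $\mathbf{Doc}_{\rm flat}$ has the flat morphisms as 1-cells. The *free geometric completion* $\mathfrak{Z}_{\rm Fr}(P):\mathcal C^{op}\to\mathbf{PreOrd}$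 has as elements over $c$ the sets $S$ of pairs $(f:d\to c,\ x\in P(d))$ such that $(f,x)\in S$ and $y\le P(g)(x)$ imply $(f g,y)\in S$, ordered by inclusion, with $\mathfrak{Z}_{\rm Fr}(P)(f)(S)=\{(g,y)\mid (fg,y)\in S\}$, left adjoints $\exists_f S=\{(fg,y)\mid (g,y)\in S\}$, unit $\eta^P(x)={\downarrow}x=\{(g,y)\mid y\le P(g)(x)\}$ and multiplication $\mu^P(U)=\bigcup_{(g,S)\in U}\exists_g S$; a flat $(F,a):P\to Q$ induces $S\mapsto\bigcup_{(g,x)\in S}\exists_{F(g)}{\downarrow}a(x)$. $K_P$ denotes the topology on $\mathcal C\rtimes\mathfrak{Z}_{\rm Fr}(P)$ in which $\{f_i:(c_i,U_i)\to(d,V)\}$ covers iff $V=\bigvee_i\exists_{f_i}U_i$. 2-functors, 2-monads and their algebras are strict. Let $A\text{-}\mathbf{Doc}$ be a 2-full sub-2-category of $\mathbf{Doc}_{\rm flat}$ to which $(\mathfrak{Z}_{\rm Fr},\eta,\mu)$ restricts: it contains $\mathfrak{Z}_{\rm Fr}(P)$, $\eta^P$ and $\mu^P$ for its objects $P$, and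 $\mathfrak{Z}_{\rm Fr}(\theta)$ for its 1-cells $\theta$. Suppose that for each $P\in A\text{-}\mathbf{Doc}$ a subdoctrine $H^P:TP\hookrightarrow\mathfrak{Z}_{\rm Fr}(P)$ is chosen (subsets $TP(c)\subseteq\mathfrak{Z}_{\rm Fr}(P)(c)$ with the induced order, stable under reindexing), with $TP$ and $H^P$ in $A\text{-}\mathbf{Doc}$. The choice is *$A$-compatible* if 1. $\eta^P$ factors through $H^P$ by a morphism $\varepsilon^P:P\to TP$ of $A\text{-}\mathbf{Doc}$; 2. for each $\theta:P\to Q$ of $A\text{-}\mathbf{Doc}$, $\mathfrak{Z}_{\rm Fr}(\theta)$ restricts to a morphism $T\theta:TP\to TQ$ of $A\text{-}\mathbf{Doc}$; 3. $\mu^P\circ H^{\mathfrak{Z}_{\rm Fr}(P)}\circ T(H^P):TTP\to\mathfrak{Z}_{\rm Fr}(P)$ factors through $H^P$ by a morphism $\nu^P:TTP\to TP$ of $A\text{-}\mathbf{Doc}$. Then, with $T\alpha=\alpha$ on 2-cells, $(T,\varepsilon,\nu)$ is a 2-monad on $A\text{-}\mathbf{Doc}$, called a *compatible subcompletion*. **Theorem.**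 Let $(T,\varepsilon,\nu)$ be a compatible subcompletion on $A\text{-}\mathbf{Doc}$. (a) $T$ is *sub-geometric*: there are $T$-algebra structures $\xi^P:T\mathfrak{Z}_{\rm Fr}(P)\to\mathfrak{Z}_{\rm Fr}(P)$ and Grothendieck topologies $J^T_P$ on $\mathcal C\rtimes TP$, for $P:\mathcal C^{op}\to\mathbf{PreOrd}$ in $A\text{-}\mathbf{Doc}$, such that $\varepsilon^P:(P,J_{\rm triv})\to(TP,J^T_P)$, $\xi^P:(T\mathfrak{Z}_{\rm Fr}(P),J^T_{\mathfrak{Z}_{\rm Fr}(P)})\to(\mathfrak{Z}_{\rm Fr}(P),K_P)$ and $T\theta:(TP,J^T_P)\to(TQ,J^T_Q)$, for every 1-cell $\theta:P\to Q$ of $A\text{-}\mathbf{Doc}$, are morphisms of doctrinal sites. (b) $T$ is *lax-idempotent*: there are 2-cells $\lambda_P:T\varepsilon^P\Rightarrow\varepsilon^{TP}$, forming a modification in $P$, such that $\lambda_P\ast\varepsilon^P$ and $\nu^P\ast\lambda_P$ are identities. (c) Let $\mathbf{PrimDoc}$ be the 2-category of primary doctrines: $\mathcal C$ has finite limits, the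 fibres are posets with finite meets (including a top), preserved by reindexing; the 1-cells are the $(F,a)$ such that $F$ preserves finite limits and each $a_c$ preserves finite meets, and all 2-cells are kept. $\mathbf{PrimDoc}$ satisfies the assumptions on $A\text{-}\mathbf{Doc}$. Taking for $TP(c)$ the supercompact elements (those $S$ such that every $K_P$-cover of $(c,S)$ contains a one-element $K_P$-cover) is $\mathbf{PrimDoc}$-compatible, and so is taking the compact elements (every $K_P$-cover of $(c,S)$ contains a finite $K_P$-cover). In the supercompact case $TP$ is the existential completion $P^\exists$ of $P$: over $c$, $P^\exists(c)$ is the poset reflection of the preorder of pairs $(f:d\to c,\ x\in P(d))$ in which $(g,y)\le(f,x)$ iff $g=fh$ and $y\le P(h)(x)$ for some $h$; for a pullback square $fh=gk$ the map $P^\exists(g)$ sends $(f,x)$ to $(k,P(h)(x))$; and $(f,x)\mapsto\exists_f{\downarrow}x$ is an isomorphism $P^\exists\cong TP$. -/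

import Mathlib

open CategoryTheory Opposite Bicategory

universe w v u

set_option linter.unusedVariables false
set_option linter.checkUnivs false

/-! ### Morphisms of sites -/

/-- `F : (C, J) ⥤ (D, K)` is a morphism of sites. A covering family is given through the covering
sieve that it generates. -/
structure IsMorphismOfSites {C : Type*} [Category C] {D : Type*} [Category D]
    (J : GrothendieckTopology C) (K : GrothendieckTopology D) (F : C ⥤ D) : Prop where
  cover : ∀ ⦃c : C⦄ (S : Sieve c), S ∈ J c → S.functorPushforward F ∈ K (F.obj c)
  inhabited : ∀ d : D, ∃ R ∈ K d, ∀ ⦃e : D⦄ (h : e ⟶ d), R h → ∃ c : C, Nonempty (e ⟶ F.obj c)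
  pair : ∀ ⦃c₁ c₂ : C⦄ ⦃d : D⦄ (g₁ : d ⟶ F.obj c₁) (g₂ : d ⟶ F.obj c₂),
    ∃ R ∈ K d, ∀ ⦃e : D⦄ (h : e ⟶ d), R h →
      ∃ (c : C) (f₁ : c ⟶ c₁) (f₂ : c ⟶ c₂) (k : e ⟶ F.obj c),
        k ≫ F.map f₁ = h ≫ g₁ ∧ k ≫ F.map f₂ = h ≫ g₂
  parallel : ∀ ⦃c' c : C⦄ (f₁ f₂ : c' ⟶ c) ⦃d : D⦄ (g : d ⟶ F.obj c'),
    g ≫ F.map f₁ = g ≫ F.map f₂ →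
    ∃ R ∈ K d, ∀ ⦃e : D⦄ (h : e ⟶ d), R h →
      ∃ (c'' : C) (l : c'' ⟶ c') (k : e ⟶ F.obj c''),
        l ≫ f₁ = l ≫ f₂ ∧ k ≫ F.map l = h ≫ g

/-- A functor is flat if it is a morphism of sites for the trivial topologies
(`⊥`: only maximal sieves cover). -/
def IsFlatFunctor {C : Type*} [Category C] {D : Type*} [Category D] (F : C ⥤ D) : Prop :=
  IsMorphismOfSites (⊥ : GrothendieckTopology C) (⊥ : GrothendieckTopology D) F

/-! ### 2-monads on strict 2-categories -/

/-- A (strict) 2-monad on a strict 2-category. Equations between 2-cells whose sources (targets)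
are only propositionally equal 1-cells are mediated by `eqToHom`, the identity 2-cells. -/
structure TwoMonad (B : Type*) [Bicategory B] [Bicategory.Strict B] where
  T : StrictPseudofunctor B B
  unit : ∀ a : B, a ⟶ T.obj a
  mult : ∀ a : B, T.obj (T.obj a) ⟶ T.obj a
  unit_natural : ∀ {a b : B} (f : a ⟶ b), f ≫ unit b = unit a ≫ T.map f
  unit_natural₂ : ∀ {a b : B} {f g : a ⟶ b} (θ : f ⟶ g),
    θ ▷ unit b = eqToHom (unit_natural f) ≫ unit a ◁ T.map₂ θ ≫ eqToHom (unit_natural g).symm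
  mult_natural : ∀ {a b : B} (f : a ⟶ b), T.map (T.map f) ≫ mult b = mult a ≫ T.map f
  mult_natural₂ : ∀ {a b : B} {f g : a ⟶ b} (θ : f ⟶ g),
    T.map₂ (T.map₂ θ) ▷ mult b =
      eqToHom (mult_natural f) ≫ mult a ◁ T.map₂ θ ≫ eqToHom (mult_natural g).symm
  assoc : ∀ a : B, T.map (mult a) ≫ mult a = mult (T.obj a) ≫ mult a
  left_unit : ∀ a : B, unit (T.obj a) ≫ mult a = 𝟙 (T.obj a)
  right_unit : ∀ a : B, T.map (unit a) ≫ mult a = 𝟙 (T.obj a)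

namespace TwoMonad

variable {B : Type*} [Bicategory B] [Bicategory.Strict B]

/-- `ξ : T x ⟶ x` is a (strict) algebra structure on `x`. -/
def IsAlgebra (M : TwoMonad B) {x : B} (ξ : M.T.obj x ⟶ x) : Prop :=
  M.unit x ≫ ξ = 𝟙 x ∧ M.T.map ξ ≫ ξ = M.mult x ≫ ξ

/-- Lax-idempotency: there are 2-cells `l a : T (unit a) ⟶ unit (T a)`, natural in `a`
(a modification), such that both `l a` precomposed with `unit a` and `l a` postcomposed with
`mult a` are identity 2-cells. -/
def IsLaxIdempotent (M : TwoMonad B) : Prop :=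
  ∃ l : ∀ a : B, M.T.map (M.unit a) ⟶ M.unit (M.T.obj a),
    (∀ {a b : B} (f : a ⟶ b),
      M.T.map f ◁ l b =
        eqToHom (by rw [← M.T.map_comp, M.unit_natural, M.T.map_comp]) ≫
          l a ▷ M.T.map (M.T.map f) ≫ eqToHom (M.unit_natural (M.T.map f)).symm) ∧
    (∀ a : B, M.unit a ◁ l a = eqToHom (M.unit_natural (M.unit a)).symm) ∧
    (∀ a : B, l a ▷ M.mult a = eqToHom ((M.right_unit a).trans (M.left_unit a).symm))

end TwoMonad

/-! ### 2-full sub-2-categories -/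

/-- A 2-full sub-2-category of a bicategory: a class of objects and a class of 1-cells,
closed under identities and composition; all 2-cells between the chosen 1-cells are kept. -/
structure Sub2Category (B : Type*) [Bicategory B] where
  obj : B → Prop
  hom : ∀ {a b : B}, (a ⟶ b) → Prop
  id_mem : ∀ {a : B}, obj a → hom (𝟙 a)
  comp_mem : ∀ {a b c : B}, obj a → obj b → obj c → ∀ {f : a ⟶ b} {g : b ⟶ c},
    hom f → hom g → hom (f ≫ g)

namespace Sub2Category

variable {B : Type*} [Bicategory B]

/-- The objects of the sub-2-category. -/
structure Obj (A : Sub2Category B) where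
  of : B
  mem : A.obj of

variable {A : Sub2Category B}

/-- The 1-cells of the sub-2-category. -/
structure Hom (X Y : A.Obj) where
  hom : X.of ⟶ Y.of
  mem : A.hom hom

instance : CategoryStruct A.Obj where
  Hom := Hom
  id X := ⟨𝟙 X.of, A.id_mem X.mem⟩
  comp {X Y Z} f g := ⟨f.hom ≫ g.hom, A.comp_mem X.mem Y.mem Z.mem f.mem g.mem⟩

theorem hom_ext {X Y : A.Obj} {f g : X ⟶ Y} (h : f.hom = g.hom) : f = g := by
  obtain ⟨f, hf⟩ : Hom X Y := f
  obtain ⟨g, hg⟩ : Hom X Y := g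
  obtain rfl : f = g := h
  rfl

instance (X Y : A.Obj) : Category (X ⟶ Y) where
  Hom f g := f.hom ⟶ g.hom
  id f := 𝟙 f.hom
  comp α β := α ≫ β
  id_comp _ := Category.id_comp _
  comp_id _ := Category.comp_id _
  assoc _ _ _ := Category.assoc _ _ _

/-- An invertible 2-cell, seen in the sub-2-category. -/
def isoMk {X Y : A.Obj} {f g : X ⟶ Y} (e : f.hom ≅ g.hom) : f ≅ g where
  hom := e.hom
  inv := e.inv
  hom_inv_id := e.hom_inv_id
  inv_hom_id := e.inv_hom_id

instance : Bicategory A.Obj where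
  homCategory _ _ := inferInstance
  whiskerLeft f _ _ η := Bicategory.whiskerLeft f.hom η
  whiskerRight η h := Bicategory.whiskerRight η h.hom
  associator f g h := isoMk (α_ f.hom g.hom h.hom)
  leftUnitor f := isoMk (λ_ f.hom)
  rightUnitor f := isoMk (ρ_ f.hom)
  whiskerLeft_id f g := Bicategory.whiskerLeft_id f.hom g.hom
  whiskerLeft_comp f _ _ _ η θ := Bicategory.whiskerLeft_comp f.hom η θ
  id_whiskerLeft η := Bicategory.id_whiskerLeft (B := B) η
  comp_whiskerLeft f g _ _ η := Bicategory.comp_whiskerLeft f.hom g.hom η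
  id_whiskerRight f g := Bicategory.id_whiskerRight f.hom g.hom
  comp_whiskerRight η θ i := Bicategory.comp_whiskerRight (B := B) η θ i.hom
  whiskerRight_id η := Bicategory.whiskerRight_id (B := B) η
  whiskerRight_comp η g h := Bicategory.whiskerRight_comp (B := B) η g.hom h.hom
  whisker_assoc f _ _ η h := Bicategory.whisker_assoc f.hom η h.hom
  whisker_exchange η θ := Bicategory.whisker_exchange (B := B) η θ
  pentagon f g h i := Bicategory.pentagon f.hom g.hom h.hom i.hom
  triangle f g := Bicategory.triangle f.hom g.hom

theorem eqToHom_eq {X Y : A.Obj} {f g : X ⟶ Y} (h : f = g) :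
    (eqToHom h : f ⟶ g) = (eqToHom (congrArg Hom.hom h) : f.hom ⟶ g.hom) := by
  cases h; rfl

instance [Bicategory.Strict B] : Bicategory.Strict A.Obj where
  id_comp f := hom_ext (Bicategory.Strict.id_comp f.hom)
  comp_id f := hom_ext (Bicategory.Strict.comp_id f.hom)
  assoc f g h := hom_ext (Bicategory.Strict.assoc f.hom g.hom h.hom)
  leftUnitor_eqToIso f := Iso.ext <| by
    rw [eqToIso.hom, eqToHom_eq]
    exact (congrArg Iso.hom (Bicategory.Strict.leftUnitor_eqToIso f.hom)).trans (eqToIso.hom _)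
  rightUnitor_eqToIso f := Iso.ext <| by
    rw [eqToIso.hom, eqToHom_eq]
    exact (congrArg Iso.hom (Bicategory.Strict.rightUnitor_eqToIso f.hom)).trans (eqToIso.hom _)
  associator_eqToIso f g h := Iso.ext <| by
    rw [eqToIso.hom, eqToHom_eq]
    exact (congrArg Iso.hom (Bicategory.Strict.associator_eqToIso f.hom g.hom h.hom)).trans (eqToIso.hom _)

end Sub2Category

/-! ### Doctrines -/

/-- A doctrine: a functor `Cᵒᵖ ⥤ Preord` on an arbitrary category `C`. (The universe of the fibres
is chosen so that the free geometric completion stays in it.) -/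
structure Doctrine : Type (max (u + 1) (v + 1) (w + 1)) where
  base : Type u
  [cat : Category.{v} base]
  fib : baseᵒᵖ ⥤ Preord.{max u v w}

namespace Doctrine

attribute [instance] Doctrine.cat

/-- The fibre `P(c)`. -/
abbrev fibre (P : Doctrine.{w, v, u}) (c : P.base) : Type (max u v w) := P.fib.obj (op c)

/-- The reindexing map `P(f) : P(c) → P(d)` along `f : d ⟶ c`. -/
def re (P : Doctrine.{w, v, u}) {c d : P.base} (f : d ⟶ c) : P.fibre c →o P.fibre d :=
  (P.fib.map f.op).hom

variable (P : Doctrine.{w, v, u})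

@[simp]
theorem re_id {c : P.base} (x : P.fibre c) : P.re (𝟙 c) x = x := by
  simp [re]

theorem re_comp {c d e : P.base} (f : d ⟶ c) (g : e ⟶ d) (x : P.fibre c) :
    P.re (g ≫ f) x = P.re g (P.re f x) := by
  simp [re]

/-- A morphism of doctrines `(F, a)`: a functor `F` and a natural transformation
`a : P ⟶ Fᵒᵖ ⋙ Q`. -/
structure Hom (P Q : Doctrine.{w, v, u}) where
  functor : P.base ⥤ Q.base
  trans : P.fib ⟶ functor.op ⋙ Q.fib

/-- The component `a_c : P(c) → Q(F c)`. -/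
def Hom.app {P Q : Doctrine.{w, v, u}} (f : Hom P Q) (c : P.base) :
    P.fibre c →o Q.fibre (f.functor.obj c) :=
  (f.trans.app (op c)).hom

theorem Hom.app_re {P Q : Doctrine.{w, v, u}} (f : Hom P Q) {c d : P.base} (g : d ⟶ c)
    (x : P.fibre c) : f.app d (P.re g x) = Q.re (f.functor.map g) (f.app c x) :=
  congrArg (fun t => t.hom x) (f.trans.naturality g.op)

/-- Construct a morphism of doctrines from its components. -/
def Hom.ofApp {P Q : Doctrine.{w, v, u}} (F : P.base ⥤ Q.base)
    (a : ∀ c, P.fibre c →o Q.fibre (F.obj c))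
    (nat : ∀ ⦃c d : P.base⦄ (g : d ⟶ c) (x : P.fibre c),
      a d (P.re g x) = Q.re (F.map g) (a c x)) : Hom P Q where
  functor := F
  trans :=
    { app := fun c => Preord.ofHom (a c.unop)
      naturality := fun c d g => by
        ext x
        exact nat g.unop x }

instance : CategoryStruct Doctrine.{w, v, u} where
  Hom := Hom
  id P := ⟨𝟭 _, 𝟙 P.fib⟩
  comp f g := ⟨f.functor ⋙ g.functor, f.trans ≫ Functor.whiskerLeft f.functor.op g.trans⟩

theorem hom_ext {P Q : Doctrine.{w, v, u}} {f g : P ⟶ Q} (h : f.functor = g.functor)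
    (h' : ∀ (c : P.base) (x : P.fibre c),
      f.app c x = Q.re (eqToHom (congrArg (fun F => F.obj c) h)) (g.app c x)) : f = g := by
  obtain ⟨F, a⟩ := f
  obtain ⟨G, b⟩ := g
  obtain rfl : F = G := h
  congr 1
  ext c x
  have := h' c.unop x
  rw [eqToHom_refl, re_id] at this
  exact this

/-- A 2-cell `(F, a) ⟶ (F', a')`: a natural transformation `α : F ⟶ F'` with
`a_c(x) ≤ Q(α_c)(a'_c(x))`. -/
@[ext]
structure Hom₂ {P Q : Doctrine.{w, v, u}} (f g : P ⟶ Q) where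
  nat : f.functor ⟶ g.functor
  le : ∀ (c : P.base) (x : P.fibre c), f.app c x ≤ Q.re (nat.app c) (g.app c x)

instance (P Q : Doctrine.{w, v, u}) : Category (P ⟶ Q) where
  Hom := Hom₂
  id f := ⟨𝟙 _, fun c x => (Q.re_id _).ge⟩
  comp {f g h} α β := ⟨α.nat ≫ β.nat, fun c x => by
    rw [NatTrans.comp_app, re_comp]
    exact (α.le c x).trans ((Q.re _).monotone (β.le c x))⟩
  id_comp _ := Hom₂.ext (Category.id_comp _)
  comp_id _ := Hom₂.ext (Category.comp_id _)
  assoc _ _ _ := Hom₂.ext (Category.assoc _ _ _)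

theorem hom₂_ext {P Q : Doctrine.{w, v, u}} {f g : P ⟶ Q} {α β : f ⟶ g}
    (h : α.nat = β.nat) : α = β :=
  Hom₂.ext h

theorem le₂ {P Q : Doctrine.{w, v, u}} {f g : P ⟶ Q} (α : f ⟶ g) (c : P.base) (x : P.fibre c) :
    f.app c x ≤ Q.re (α.nat.app c) (g.app c x) :=
  Hom₂.le α c x

/-- Invertible 2-cells between 1-cells with the same components up to `e`. -/
def isoMk {P Q : Doctrine.{w, v, u}} {f g : P ⟶ Q} (e : f.functor ≅ g.functor)
    (h : ∀ (c : P.base) (x : P.fibre c), f.app c x ≤ Q.re (e.hom.app c) (g.app c x))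
    (h' : ∀ (c : P.base) (x : P.fibre c), g.app c x ≤ Q.re (e.inv.app c) (f.app c x)) :
    f ≅ g where
  hom := ⟨e.hom, h⟩
  inv := ⟨e.inv, h'⟩
  hom_inv_id := hom₂_ext e.hom_inv_id
  inv_hom_id := hom₂_ext e.inv_hom_id

/-- The 2-category **Doc** of doctrines. -/
instance : Bicategory Doctrine.{w, v, u} where
  homCategory P Q := inferInstance
  whiskerLeft f _ _ η :=
    Hom₂.mk (Functor.whiskerLeft f.functor η.nat) (fun c x => le₂ η _ (f.app c x))
  whiskerRight η h :=
    Hom₂.mk (Functor.whiskerRight η.nat h.functor)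
      (fun c x => ((h.app _).monotone (le₂ η c x)).trans (h.app_re _ _).le)
  associator {_ _ _ S} f g h :=
    isoMk (Functor.associator f.functor g.functor h.functor)
      (fun c x => (S.re_id _).ge) (fun c x => (S.re_id _).ge)
  leftUnitor {_ Q} f :=
    isoMk (Functor.leftUnitor f.functor) (fun c x => (Q.re_id _).ge) (fun c x => (Q.re_id _).ge)
  rightUnitor {_ Q} f :=
    isoMk (Functor.rightUnitor f.functor) (fun c x => (Q.re_id _).ge) (fun c x => (Q.re_id _).ge)
  whiskerLeft_id _ _ := hom₂_ext rfl
  whiskerLeft_comp _ _ _ _ _ _ := hom₂_ext rfl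
  id_whiskerLeft η := hom₂_ext <| NatTrans.ext <| funext fun c =>
    ((Category.id_comp _).trans (Category.comp_id _)).symm
  comp_whiskerLeft _ _ _ _ η := hom₂_ext <| NatTrans.ext <| funext fun c =>
    ((Category.id_comp _).trans (Category.comp_id _)).symm
  id_whiskerRight _ g := hom₂_ext <| NatTrans.ext <| funext fun c => g.functor.map_id _
  comp_whiskerRight _ _ i := hom₂_ext <| NatTrans.ext <| funext fun c => i.functor.map_comp _ _
  whiskerRight_id _ := hom₂_ext <| NatTrans.ext <| funext fun c =>
    ((Category.id_comp _).trans (Category.comp_id _)).symm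
  whiskerRight_comp _ _ _ := hom₂_ext <| NatTrans.ext <| funext fun c =>
    ((Category.id_comp _).trans (Category.comp_id _)).symm
  whisker_assoc _ _ _ _ _ := hom₂_ext <| NatTrans.ext <| funext fun c =>
    ((Category.id_comp _).trans (Category.comp_id _)).symm
  whisker_exchange η θ := hom₂_ext <| NatTrans.ext <| funext fun c =>
    (θ.nat.naturality (η.nat.app c)).symm
  pentagon _ _ _ i := hom₂_ext <| NatTrans.ext <| funext fun c =>
    congrArg₂ (· ≫ ·) (i.functor.map_id _) (Category.id_comp _)
  triangle _ g := hom₂_ext <| NatTrans.ext <| funext fun c =>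
    (Category.id_comp _).trans (g.functor.map_id _).symm

theorem eqToHom_nat {P Q : Doctrine.{w, v, u}} {f g : P ⟶ Q} (h : f = g) :
    (eqToHom h).nat = eqToHom (congrArg Hom.functor h) := by
  cases h; rfl

instance : Bicategory.Strict Doctrine.{w, v, u} where
  id_comp _ := rfl
  comp_id _ := rfl
  assoc _ _ _ := rfl
  leftUnitor_eqToIso _ := Iso.ext rfl
  rightUnitor_eqToIso _ := Iso.ext rfl
  associator_eqToIso _ _ _ := Iso.ext rfl

/-! ### The category of elements and doctrinal sites -/

/-- Objects `(c, x)`, `x ∈ P(c)`, of the Grothendieck construction `C ⋊ P`. -/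
structure Total (P : Doctrine.{w, v, u}) where
  pt : P.base
  elt : P.fibre pt

/-- An arrow `(c, x) ⟶ (d, y)` of `C ⋊ P` is an arrow `f : c ⟶ d` with `x ≤ P(f)(y)`. -/
@[ext]
structure Total.Hom (X Y : P.Total) where
  arrow : X.pt ⟶ Y.pt
  elt_le : X.elt ≤ P.re arrow Y.elt

instance : Category P.Total where
  Hom := Total.Hom P
  id X := ⟨𝟙 _, (P.re_id _).ge⟩
  comp f g := ⟨f.arrow ≫ g.arrow, by
    rw [re_comp]
    exact f.elt_le.trans ((P.re _).monotone g.elt_le)⟩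
  id_comp _ := Total.Hom.ext (Category.id_comp _)
  comp_id _ := Total.Hom.ext (Category.comp_id _)
  assoc _ _ _ := Total.Hom.ext (Category.assoc _ _ _)

variable {P}

/-- The functor `F ⋊ a : C ⋊ P ⥤ D ⋊ Q` induced by a morphism `(F, a)` of doctrines. -/
def totalMap {P Q : Doctrine.{w, v, u}} (f : P ⟶ Q) : P.Total ⥤ Q.Total where
  obj X := ⟨f.functor.obj X.pt, f.app X.pt X.elt⟩
  map {X Y} g := Total.Hom.mk (f.functor.map g.arrow) (by
    have h := (f.app X.pt).monotone g.elt_le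
    rwa [Hom.app_re] at h)
  map_id X := Total.Hom.ext (f.functor.map_id _)
  map_comp g h := Total.Hom.ext (f.functor.map_comp _ _)

/-- `(F, a)` is a morphism of doctrinal sites `(P, J) ⟶ (Q, K)`: `F` is flat and `F ⋊ a` is a
morphism of sites. -/
def IsSiteHom {P Q : Doctrine.{w, v, u}} (J : GrothendieckTopology P.Total)
    (K : GrothendieckTopology Q.Total) (f : P ⟶ Q) : Prop :=
  IsFlatFunctor f.functor ∧ IsMorphismOfSites J K (totalMap f)

/-- Flat morphisms of doctrines, the 1-cells of **Doc**_flat: morphisms of doctrinal sites for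
the trivial topologies. -/
def IsFlat {P Q : Doctrine.{w, v, u}} (f : P ⟶ Q) : Prop :=
  IsSiteHom (⊥ : GrothendieckTopology P.Total) (⊥ : GrothendieckTopology Q.Total) f

/-! ### The free geometric completion -/

/-- An element `S` of the free geometric completion of `P` at `c`: a set of pairs `(f, x)`, with
`f : d ⟶ c` and `x ∈ P(d)`, closed under passing to `(g ≫ f, y)` with `y ≤ P(g)(x)`. -/
@[ext]
structure FreeElt (P : Doctrine.{w, v, u}) (c : P.base) : Type (max u v w) where
  mem : ∀ ⦃d : P.base⦄, (d ⟶ c) → P.fibre d → Prop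
  down : ∀ ⦃d e : P.base⦄ (f : d ⟶ c) (x : P.fibre d) (g : e ⟶ d) (y : P.fibre e),
    mem f x → y ≤ P.re g x → mem (g ≫ f) y

namespace FreeElt

/-- The order is inclusion. -/
instance (c : P.base) : PartialOrder (FreeElt P c) where
  le S S' := ∀ ⦃d : P.base⦄ (f : d ⟶ c) (x : P.fibre d), S.mem f x → S'.mem f x
  le_refl _ _ _ _ h := h
  le_trans _ _ _ h h' _ f x hx := h' f x (h f x hx)
  le_antisymm S S' h h' := by
    ext d f x
    exact ⟨h f x, h' f x⟩

/-- `f^*(S) = {(g, y) | (g ≫ f, y) ∈ S}`. -/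
def pull {c d : P.base} (f : d ⟶ c) : FreeElt P c →o FreeElt P d where
  toFun S :=
    { mem := fun _ g y => S.mem (g ≫ f) y
      down := fun _ _ g x h y hx hy => by
        rw [Category.assoc]
        exact S.down _ x h y hx hy }
  monotone' _ _ h _ g y hy := h (g ≫ f) y hy

/-- `∃_f S = {(g ≫ f, y) | (g, y) ∈ S}`. -/
def ex {c d : P.base} (f : d ⟶ c) (S : FreeElt P d) : FreeElt P c where
  mem e k y := ∃ g : e ⟶ d, S.mem g y ∧ g ≫ f = k
  down := by
    rintro _ e _ x h y ⟨g, hg, rfl⟩ hy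
    exact ⟨h ≫ g, S.down g x h y hg hy, Category.assoc _ _ _⟩

/-- `∃_f` is left adjoint to reindexing along `f`. -/
theorem ex_le_iff {c d : P.base} (f : d ⟶ c) (S : FreeElt P d) (S' : FreeElt P c) :
    ex f S ≤ S' ↔ S ≤ pull f S' := by
  constructor
  · intro h e g y hg
    exact h (g ≫ f) y ⟨g, hg, rfl⟩
  · rintro h e _ y ⟨g, hg, rfl⟩
    exact h g y hg

/-- The principal down-set `↓x = {(g, y) | y ≤ P(g)(x)}`. -/
def principal {c : P.base} (x : P.fibre c) : FreeElt P c where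
  mem _ g y := y ≤ P.re g x
  down _ _ f z g y hz hy := by
    rw [re_comp]
    exact hy.trans ((P.re g).monotone hz)

theorem principal_le_iff {c : P.base} (x : P.fibre c) (S : FreeElt P c) :
    principal x ≤ S ↔ S.mem (𝟙 c) x := by
  constructor
  · intro h
    exact h (𝟙 c) x (P.re_id x).ge
  · intro h d g y hy
    have := S.down (𝟙 c) x g y h hy
    rwa [Category.comp_id] at this

end FreeElt

/-- The (underlying doctrine of the) free geometric completion of `P`. -/
abbrev free (P : Doctrine.{w, v, u}) : Doctrine.{w, v, u} where
  base := P.base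
  fib :=
    { obj := fun c => Preord.of (FreeElt P c.unop)
      map := fun f => Preord.ofHom (FreeElt.pull f.unop)
      map_id := fun c => by
        ext S
        exact iff_of_eq (congrArg (fun t => FreeElt.mem S t _) (Category.comp_id _))
      map_comp := fun f g => by
        ext S
        exact iff_of_eq (congrArg (fun t => FreeElt.mem S t _) (Category.assoc _ _ _).symm) }

theorem free_mem_re {c d e : P.base} (f : d ⟶ c) (S : FreeElt P c) (g : e ⟶ d) (y : P.fibre e) :
    FreeElt.mem (P := P) ((free P).re (c := c) (d := d) f S) g y ↔ S.mem (g ≫ f) y :=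
  Iff.rfl

/-- The unit `x ↦ ↓x` of the free geometric completion. -/
def freeUnit (P : Doctrine.{w, v, u}) : P ⟶ free P :=
  Hom.ofApp (Q := free P) (𝟭 P.base)
    (fun c =>
      { toFun := fun x => (FreeElt.principal x : FreeElt P c)
        monotone' := fun x y h d g z hz => hz.trans ((P.re g).monotone h) })
    (fun c d g x => by
      refine FreeElt.ext ?_
      funext e h y
      exact congrArg (fun t => y ≤ t) (P.re_comp g h x).symm)

/-- The action of the free geometric completion on an element, for a morphism `(F, a)`:
the join of the elements `∃_{F g} ↓a(x)`, for `(g, x) ∈ S`. -/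
def freeApp {P Q : Doctrine.{w, v, u}} (f : P ⟶ Q) {c : P.base} (S : FreeElt P c) :
    FreeElt Q (f.functor.obj c) where
  mem e k y := ∃ (d : P.base) (g : d ⟶ c) (x : P.fibre d), S.mem g x ∧
    (FreeElt.ex (f.functor.map g) (FreeElt.principal (f.app d x))).mem k y
  down := by
    rintro _ e k y h z ⟨d, g, x, hx, hk⟩ hz
    exact ⟨d, g, x, hx, FreeElt.down _ k y h z hk hz⟩

theorem freeApp_mono {P Q : Doctrine.{w, v, u}} (f : P ⟶ Q) {c : P.base} {S S' : FreeElt P c}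
    (h : S ≤ S') : freeApp f S ≤ freeApp f S' := by
  rintro e k y ⟨d, g, x, hx, hk⟩
  exact ⟨d, g, x, h g x hx, hk⟩

theorem freeApp_pull {P Q : Doctrine.{w, v, u}} (f : P ⟶ Q) (hf : IsFlatFunctor f.functor)
    {c d : P.base} (g : d ⟶ c) (S : FreeElt P c) :
    freeApp f (FreeElt.pull g S) = FreeElt.pull (f.functor.map g) (freeApp f S) := by
  refine le_antisymm ?_ ?_
  · rintro e _ y ⟨b, h, x, hx, k, hk, rfl⟩
    exact ⟨b, h ≫ g, x, hx, k, hk, by rw [f.functor.map_comp, Category.assoc]⟩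
  · rintro e l y ⟨b, h, x, hx, k, hk, hl⟩
    obtain ⟨R, hR, H⟩ := hf.pair l k
    rw [GrothendieckTopology.bot_covering] at hR
    obtain ⟨b', p, q, m, hm, hm'⟩ := H (𝟙 e) (by rw [hR]; trivial)
    rw [Category.id_comp] at hm hm'
    obtain ⟨R', hR', H'⟩ := hf.parallel (p ≫ g) (q ≫ h) m (by
      rw [f.functor.map_comp, f.functor.map_comp, ← Category.assoc, ← Category.assoc, hm, hm', hl])
    rw [GrothendieckTopology.bot_covering] at hR'
    obtain ⟨b'', r, n, hr, hn⟩ := H' (𝟙 e) (by rw [hR']; trivial)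
    rw [Category.id_comp] at hn
    refine ⟨b'', r ≫ p, P.re (r ≫ q) x, ?_, n, ?_, ?_⟩
    · have := S.down h x (r ≫ q) _ hx le_rfl
      rw [Category.assoc, ← hr, ← Category.assoc] at this
      exact this
    · change y ≤ Q.re n (f.app b'' (P.re (r ≫ q) x))
      rw [Hom.app_re, ← re_comp, f.functor.map_comp, ← Category.assoc, hn, hm']
      exact hk
    · rw [f.functor.map_comp, ← Category.assoc, hn, hm]

/-- The free geometric completion on flat morphisms of doctrines. -/
def freeMap {P Q : Doctrine.{w, v, u}} (f : P ⟶ Q) (hf : IsFlat f) : free P ⟶ free Q :=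
  Hom.ofApp (P := free P) (Q := free Q) f.functor
    (fun c =>
      { toFun := fun S => freeApp f (c := c) S
        monotone' := fun _ _ h => freeApp_mono f h })
    (fun _ _ g S => freeApp_pull f hf.1 g S)

/-- The join of the elements `∃_g S`, for `(g, S) ∈ U`. -/
def freeJoin {c : P.base} (U : FreeElt (free P) c) : FreeElt P c where
  mem e k y := ∃ (d : P.base) (g : d ⟶ c) (S : FreeElt P d), U.mem g S ∧ (FreeElt.ex g S).mem k y
  down := by
    rintro _ e k y h z ⟨d, g, S, hS, hk⟩ hz
    exact ⟨d, g, S, hS, FreeElt.down _ k y h z hk hz⟩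

/-- The multiplication of the free geometric completion. -/
def freeMult (P : Doctrine.{w, v, u}) : free (free P) ⟶ free P :=
  Hom.ofApp (P := free (free P)) (Q := free P) (𝟭 P.base)
    (fun c =>
      { toFun := fun U => freeJoin (P := P) (c := c) U
        monotone' := by
          rintro U U' h e k y ⟨d, g, S, hS, hk⟩
          exact ⟨d, g, S, h g S hS, hk⟩ })
    (fun c d g U => by
      refine le_antisymm (α := FreeElt P d) ?_ ?_
      · rintro e _ y ⟨b, h, S, hS, k, hk, rfl⟩
        exact ⟨b, h ≫ g, S, hS, k, hk, (Category.assoc _ _ _).symm⟩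
      · rintro e l y ⟨b, h, S, hS, k, hk, hl⟩
        refine ⟨e, l, FreeElt.pull k S, ?_, 𝟙 e, ?_, Category.id_comp _⟩
        · have := FreeElt.down (P := free P) U h S k (FreeElt.pull k S) hS le_rfl
          rw [hl] at this
          exact this
        · change S.mem (𝟙 e ≫ k) y
          rwa [Category.id_comp])

/-! ### The topology `K` on the free geometric completion -/

/-- The sieve `R` on `(d, V)` is `K`-covering: `V` is the join of the `∃_f U` over the arrows
`f : (c, U) ⟶ (d, V)` of `R`. -/
def IsJoinCover {X : (free P).Total} (R : Sieve X) : Prop :=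
  IsLUB {W : FreeElt P X.pt | ∃ (Y : (free P).Total) (f : Y ⟶ X), R f ∧
    W = FreeElt.ex (P := P) f.arrow Y.elt} X.elt

theorem isJoinCover_iff {X : (free P).Total} (R : Sieve X) :
    IsJoinCover R ↔ ∀ (d : P.base) (g : d ⟶ X.pt) (x : P.fibre d),
      FreeElt.mem (P := P) X.elt g x → ∃ (Y : (free P).Total) (f : Y ⟶ X), R f ∧
        ∃ h : d ⟶ Y.pt, FreeElt.mem (P := P) Y.elt h x ∧ h ≫ f.arrow = g := by
  constructor
  · intro H d g x hx
    let W : FreeElt P X.pt :=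
      { mem := fun d g x => ∃ (Y : (free P).Total) (f : Y ⟶ X), R f ∧
          (FreeElt.ex (P := P) f.arrow Y.elt).mem g x
        down := by
          rintro d e g x h y ⟨Y, f, hf, hx⟩ hy
          exact ⟨Y, f, hf, FreeElt.down _ g x h y hx hy⟩ }
    have hW : X.elt ≤ W := H.2 (by
      rintro _ ⟨Y, f, hf, rfl⟩ d g x hx
      exact ⟨Y, f, hf, hx⟩)
    exact hW g x hx
  · intro H
    constructor
    · rintro _ ⟨Y, f, _, rfl⟩
      exact (FreeElt.ex_le_iff (P := P) f.arrow Y.elt X.elt).2 f.elt_le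
    · intro W hW d g x hx
      obtain ⟨Y, f, hf, h, hh, rfl⟩ := H d g x hx
      exact hW ⟨Y, f, hf, rfl⟩ (h ≫ f.arrow) x ⟨h, hh, rfl⟩

/-- The Grothendieck topology `K` on `C ⋊ free P`. -/
def joinTopology (P : Doctrine.{w, v, u}) : GrothendieckTopology (free P).Total where
  sieves X := {R : Sieve X | IsJoinCover R}
  top_mem' X := by
    refine (isJoinCover_iff _).2 fun d g x hx => ⟨X, 𝟙 X, trivial, g, hx, Category.comp_id _⟩
  pullback_stable' X Y R k hR := by
    refine (isJoinCover_iff _).2 fun d g x hx => ?_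
    obtain ⟨Z, f, hf, h, hh, hg⟩ :=
      (isJoinCover_iff R).1 hR d (g ≫ k.arrow) x (k.elt_le g x hx)
    have h1 : (FreeElt.principal x : FreeElt P d) ≤ (free P).re (c := Y.pt) (d := d) g Y.elt :=
      (FreeElt.principal_le_iff x _).2 (by
        rw [free_mem_re]
        rwa [Category.id_comp])
    have h2 : (FreeElt.principal x : FreeElt P d) ≤ (free P).re (c := Z.pt) (d := d) h Z.elt :=
      (FreeElt.principal_le_iff x _).2 (by
        rw [free_mem_re]
        rwa [Category.id_comp])
    let D : (free P).Total := ⟨d, (FreeElt.principal x : FreeElt P d)⟩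
    let a : D ⟶ Y := Total.Hom.mk g h1
    let b : D ⟶ Z := Total.Hom.mk h h2
    refine ⟨D, a, ?_, 𝟙 d, ?_, Category.id_comp _⟩
    · have hab : a ≫ k = b ≫ f := Total.Hom.ext hg.symm
      change R (a ≫ k)
      rw [hab]
      exact R.downward_closed hf b
    · exact (P.re_id x).ge
  transitive' X R hR R' hR' := by
    refine (isJoinCover_iff _).2 fun d g x hx => ?_
    obtain ⟨Y, f, hf, h, hh, rfl⟩ := (isJoinCover_iff R).1 hR d g x hx
    obtain ⟨Z, f', hf', h', hh', rfl⟩ := (isJoinCover_iff _).1 (hR' hf) d h x hh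
    exact ⟨Z, f' ≫ f, hf', h', hh', (Category.assoc _ _ _).symm⟩

/-! ### The monad equations for the free geometric completion -/

theorem comp_map_comp {C D : Type*} [Category C] [Category D] (F : C ⥤ D) {a b c : C} {d e : D}
    {p : e ⟶ F.obj a} {m' : a ⟶ b} {h : e ⟶ d} {n : d ⟶ F.obj b} (w : p ≫ F.map m' = h ≫ n)
    (m : b ⟶ c) : p ≫ F.map (m' ≫ m) = h ≫ n ≫ F.map m := by
  rw [F.map_comp, ← Category.assoc, w, Category.assoc]

/-- Two morphisms into a free geometric completion with (definitionally) the same functor agree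
as soon as they agree on elements. -/
theorem hom_free_ext {P Q : Doctrine.{w, v, u}} {f g : P ⟶ free Q}
    (b : P.fib ⟶ f.functor.op ⋙ (free Q).fib) (hb : g = ⟨f.functor, b⟩)
    (h : ∀ (c : P.base) (x : P.fibre c) (e : Q.base) (k : e ⟶ f.functor.obj c) (y : Q.fibre e),
      FreeElt.mem (P := Q) (f.app c x) k y ↔
        FreeElt.mem (P := Q) (Hom.app (Q := free Q) ⟨f.functor, b⟩ c x) k y) :
    f = g := by
  obtain ⟨F, a⟩ : Hom P (free Q) := f
  subst hb
  have hab : a = b := by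
    ext c x
    exact FreeElt.ext (P := Q) (by
      funext e k y
      exact propext (h c.unop x e k y))
  rw [hab]

theorem freeMap_id (P : Doctrine.{w, v, u}) (h : IsFlat (𝟙 P)) : freeMap (𝟙 P) h = 𝟙 (free P) := by
  refine hom_free_ext (Q := P) (Hom.trans (𝟙 (free P))) rfl fun c S e k y => ?_
  constructor
  · rintro ⟨d, g, x, hx, m, hm, rfl⟩
    exact FreeElt.down S g x m y hx hm
  · intro hy
    exact ⟨e, k, y, hy, 𝟙 e, (P.re_id y).ge, Category.id_comp _⟩

theorem freeMap_comp {P Q R : Doctrine.{w, v, u}} (f : P ⟶ Q) (g : Q ⟶ R) (hf : IsFlat f)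
    (hg : IsFlat g) (h : IsFlat (f ≫ g)) : freeMap (f ≫ g) h = freeMap f hf ≫ freeMap g hg := by
  refine hom_free_ext (Q := R) (Hom.trans (freeMap f hf ≫ freeMap g hg)) rfl fun c S e k y => ?_
  constructor
  · rintro ⟨d, m, x, hx, n, hn, rfl⟩
    exact ⟨f.functor.obj d, f.functor.map m, f.app d x,
      ⟨d, m, x, hx, 𝟙 _, (Q.re_id _).ge, Category.id_comp _⟩, n, hn, rfl⟩
  · rintro ⟨d, m, x, ⟨b, l, z, hz, n, hn, rfl⟩, p, hp, rfl⟩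
    refine ⟨b, l, z, hz, p ≫ g.functor.map n, ?_, ?_⟩
    · refine hp.trans ?_
      rw [re_comp]
      refine (R.re p).monotone ?_
      have := (g.app d).monotone hn
      rw [Hom.app_re] at this
      exact this
    · rw [Category.assoc]
      exact congrArg (fun t => p ≫ t) (g.functor.map_comp _ _).symm

theorem freeUnit_natural {P Q : Doctrine.{w, v, u}} (f : P ⟶ Q) (hf : IsFlat f) :
    f ≫ freeUnit Q = freeUnit P ≫ freeMap f hf := by
  refine hom_free_ext (Q := Q) (Hom.trans (freeUnit P ≫ freeMap f hf)) rfl fun c x e k y => ?_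
  constructor
  · intro hy
    refine ⟨c, 𝟙 c, x, (P.re_id x).ge, k, hy, ?_⟩
    exact (congrArg (fun t => k ≫ t) (f.functor.map_id c)).trans (Category.comp_id k)
  · rintro ⟨d, g, z, hz, h, hh, rfl⟩
    have e₁ : ∀ {c : P.base} (g : d ⟶ c) (x : P.fibre c),
        Q.re (h ≫ f.functor.map g) (f.app c x) = Q.re h (f.app d (P.re g x)) := by
      intro c g x
      rw [re_comp, ← Hom.app_re]
    exact (hh.trans ((Q.re h).monotone ((f.app d).monotone hz))).trans (e₁ (c := c) g x).ge

theorem freeMult_natural {P Q : Doctrine.{w, v, u}} (f : P ⟶ Q) (hf : IsFlat f)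
    (hf' : IsFlat (freeMap f hf)) :
    freeMap (freeMap f hf) hf' ≫ freeMult Q = freeMult P ≫ freeMap f hf := by
  refine hom_free_ext (Q := Q) (Hom.trans (freeMult P ≫ freeMap f hf)) rfl fun c U e k y => ?_
  constructor
  · rintro ⟨d, g, S, ⟨b, m, S', hS', n, hn, rfl⟩, h, hh, rfl⟩
    obtain ⟨b', m', x, hx, p, hp, hp'⟩ := hn h y hh
    refine ⟨b', m' ≫ m, x, ⟨b, m, S', hS', m', hx, rfl⟩, p, hp, ?_⟩
    exact comp_map_comp f.functor hp' m
  · rintro ⟨d, g, x, ⟨b, m, S, hS, n, hn, rfl⟩, h, hh, rfl⟩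
    refine ⟨f.functor.obj b, f.functor.map m, freeApp f S,
      ⟨b, m, S, hS, 𝟙 _, ((free Q).re_id (freeApp f S)).ge, Category.id_comp _⟩,
      h ≫ f.functor.map n, ⟨d, n, x, hn, h, hh, rfl⟩, ?_⟩
    exact (Category.assoc _ _ _).trans
      (comp_map_comp f.functor (n := f.functor.map n) rfl m).symm

theorem freeMult_assoc (P : Doctrine.{w, v, u}) (h : IsFlat (freeMult P)) :
    freeMap (freeMult P) h ≫ freeMult P = freeMult (free P) ≫ freeMult P := by
  refine hom_free_ext (Q := P) (Hom.trans (freeMult (free P) ≫ freeMult P)) rfl fun c U e k y => ?_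
  constructor
  · rintro ⟨d, g, S, ⟨b, m, V, hV, n, hn, rfl⟩, h, hh, rfl⟩
    obtain ⟨b', m', S', hS', p, hp, hp'⟩ := hn h y hh
    refine ⟨b', m' ≫ m, S', ⟨b, m, V, hV, m', hS', rfl⟩, p, hp, ?_⟩
    exact comp_map_comp (𝟭 P.base) hp' m
  · rintro ⟨d, g, S, ⟨b, m, V, hV, n, hn, rfl⟩, h, hh, rfl⟩
    exact ⟨b, m, freeJoin V, ⟨b, m, V, hV, 𝟙 b, ((free P).re_id (freeJoin V)).ge,
      Category.id_comp _⟩, h ≫ n, ⟨d, n, S, hn, h, hh, rfl⟩, Category.assoc _ _ _⟩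

theorem freeMult_left_unit (P : Doctrine.{w, v, u}) :
    freeUnit (free P) ≫ freeMult P = 𝟙 (free P) := by
  refine hom_free_ext (Q := P) (Hom.trans (𝟙 (free P))) rfl fun c S e k y => ?_
  constructor
  · rintro ⟨d, g, S', hS', h, hh, rfl⟩
    exact hS' h y hh
  · intro hy
    exact ⟨c, 𝟙 c, S, ((free P).re_id (c := c) S).ge, k, hy, Category.comp_id _⟩

theorem freeMult_right_unit (P : Doctrine.{w, v, u}) (h : IsFlat (freeUnit P)) :
    freeMap (freeUnit P) h ≫ freeMult P = 𝟙 (free P) := by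
  refine hom_free_ext (Q := P) (Hom.trans (𝟙 (free P))) rfl fun c S e k y => ?_
  constructor
  · rintro ⟨d, g, S', ⟨b, m, x, hx, n, hn, rfl⟩, h, hh, rfl⟩
    have := S.down m x (h ≫ n) y hx (hn h y hh)
    exact (congrArg (fun t => FreeElt.mem (P := P) S t y) (Category.assoc h n m)).mp this
  · intro hy
    exact ⟨e, k, FreeElt.principal y,
      ⟨e, k, y, hy, 𝟙 e, ((free P).re_id (c := e) (FreeElt.principal y)).ge, Category.id_comp _⟩,
      𝟙 e, (P.re_id y).ge, Category.id_comp _⟩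

theorem freeMap_le₂ {P Q : Doctrine.{w, v, u}} {f g : P ⟶ Q} (hf : IsFlat f) (hg : IsFlat g)
    (α : f ⟶ g) (c : P.base) (S : FreeElt P c) :
    (freeMap f hf).app c S ≤ (free Q).re (c := g.functor.obj c) (d := f.functor.obj c)
      (α.nat.app c) ((freeMap g hg).app c S) := by
  rintro e _ y ⟨d, m, x, hx, h, hh, rfl⟩
  refine ⟨d, m, x, hx, h ≫ α.nat.app d, ?_, ?_⟩
  · change y ≤ Q.re _ _
    rw [re_comp]
    exact hh.trans ((Q.re h).monotone (le₂ α d x))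
  · rw [Category.assoc, Category.assoc]
    exact (congrArg (fun t => h ≫ t) (α.nat.naturality m)).symm

/-! ### Subdoctrines -/

/-- A subdoctrine of `Q`: subsets of the fibres, stable under reindexing, with the induced
order. -/
structure Subdoctrine (Q : Doctrine.{w, v, u}) where
  carrier : ∀ c : Q.base, Set (Q.fibre c)
  re_mem : ∀ ⦃c d : Q.base⦄ (f : d ⟶ c) (x : Q.fibre c), x ∈ carrier c → Q.re f x ∈ carrier d

namespace Subdoctrine

variable {P Q : Doctrine.{w, v, u}}

/-- The doctrine underlying a subdoctrine. -/
abbrev toDoctrine (S : Subdoctrine Q) : Doctrine.{w, v, u} where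
  base := Q.base
  fib :=
    { obj := fun c => Preord.of {x : Q.fibre c.unop // x ∈ S.carrier c.unop}
      map := fun f => Preord.ofHom
        { toFun := fun x => ⟨Q.re f.unop x.1, S.re_mem _ _ x.2⟩
          monotone' := fun _ _ h => (Q.re f.unop).monotone h }
      map_id := fun c => by
        ext x
        exact Q.re_id x.1
      map_comp := fun f g => by
        ext x
        exact Q.re_comp f.unop g.unop x.1 }

/-- The inclusion of a subdoctrine. -/
def incl (S : Subdoctrine Q) : S.toDoctrine ⟶ Q :=
  Hom.ofApp (P := S.toDoctrine) (𝟭 Q.base)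
    (fun c => { toFun := fun x => x.1, monotone' := fun _ _ h => h })
    (fun _ _ _ _ => rfl)

/-- The factorisation through a subdoctrine of a morphism that takes its values in it. -/
def lift (S : Subdoctrine Q) (f : P ⟶ Q)
    (h : ∀ (c : P.base) (x : P.fibre c), f.app c x ∈ S.carrier (f.functor.obj c)) :
    P ⟶ S.toDoctrine :=
  Hom.ofApp (Q := S.toDoctrine) f.functor
    (fun c => { toFun := fun x => ⟨f.app c x, h c x⟩
                monotone' := fun _ _ hxy => (f.app c).monotone hxy })
    (fun _ _ g x => Subtype.ext (f.app_re g x))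

theorem lift_incl (S : Subdoctrine Q) (f : P ⟶ Q)
    (h : ∀ (c : P.base) (x : P.fibre c), f.app c x ∈ S.carrier (f.functor.obj c)) :
    S.lift f h ≫ S.incl = f :=
  rfl

theorem incl_mono (S : Subdoctrine Q) {f g : P ⟶ S.toDoctrine} (h : f ≫ S.incl = g ≫ S.incl) :
    f = g := by
  obtain ⟨F, a⟩ : Hom P S.toDoctrine := f
  obtain ⟨G, b⟩ : Hom P S.toDoctrine := g
  obtain rfl : F = G := congrArg Hom.functor h
  have h' := eq_of_heq (Hom.mk.inj h).2
  congr 1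
  ext c x
  exact Subtype.ext (congrArg (fun t => (t.app c).hom x) h')

end Subdoctrine

/-! ### Sub-geometric completions -/

/-- The sub-2-category `A` contains the image under the free geometric completion of its objects
and of its flat 1-cells, and the units of the free geometric completion. -/
structure AdmitsFree (A : Sub2Category Doctrine.{w, v, u}) : Prop where
  free_obj : ∀ {P : Doctrine.{w, v, u}}, A.obj P → A.obj (free P)
  free_map : ∀ {P Q : Doctrine.{w, v, u}} (f : P ⟶ Q) (hf : IsFlat f),
    A.obj P → A.obj Q → A.hom f → A.hom (freeMap f hf)
  free_unit : ∀ {P : Doctrine.{w, v, u}}, A.obj P → A.hom (freeUnit P)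

variable {A : Sub2Category Doctrine.{w, v, u}}

/-- The free geometric completion of an `A`-doctrine, as an `A`-doctrine. -/
def AdmitsFree.freeObj (hA : AdmitsFree A) (P : A.Obj) : A.Obj :=
  ⟨free P.of, hA.free_obj P.mem⟩

/-- A 2-monad `(T, ε, ν)` on `A` is sub-geometric: there are `T`-algebra structures `ξ P` on the
free geometric completions, and Grothendieck topologies `J P` on the categories `D ⋊ TP`, such
that `ε P : (P, J_triv) ⟶ (TP, J P)`, `ξ P : (T (free P), J (free P)) ⟶ (free P, K)` and, for
every 1-cell `θ : P ⟶ Q` of `A`, `T θ : (TP, J P) ⟶ (TQ, J Q)` are morphisms of doctrinal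
sites. -/
def IsSubGeometric (hA : AdmitsFree A) (M : TwoMonad A.Obj) : Prop :=
  ∃ ξ : ∀ P : A.Obj, M.T.obj (hA.freeObj P) ⟶ hA.freeObj P,
    (∀ P : A.Obj, M.IsAlgebra (ξ P)) ∧
    ∃ J : ∀ P : A.Obj, GrothendieckTopology (M.T.obj P).of.Total,
      (∀ P : A.Obj, IsSiteHom (⊥ : GrothendieckTopology P.of.Total) (J P) (M.unit P).hom) ∧
      (∀ P : A.Obj, IsSiteHom (J (hA.freeObj P)) (joinTopology P.of) (ξ P).hom) ∧
      (∀ {P Q : A.Obj} (θ : P ⟶ Q), IsSiteHom (J P) (J Q) (M.T.map θ).hom)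

/-! ### Compatible subcompletions -/

/-- `A` is a sub-2-category of **Doc**_flat to which the free geometric completion, with its unit
and its multiplication, restricts. -/
structure RestrictsFree (A : Sub2Category Doctrine.{w, v, u}) : Prop extends AdmitsFree A where
  flat : ∀ {P Q : Doctrine.{w, v, u}} (f : P ⟶ Q), A.obj P → A.obj Q → A.hom f → IsFlat f
  free_mult : ∀ {P : Doctrine.{w, v, u}}, A.obj P → A.hom (freeMult P)

namespace RestrictsFree

theorem isFlat (hA : RestrictsFree A) {P Q : A.Obj} (f : P ⟶ Q) : IsFlat f.hom :=
  hA.flat f.hom P.mem Q.mem f.mem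

/-- The free geometric completion on a 1-cell of `A`, as a 1-cell of `A`. -/
def map (hA : RestrictsFree A) {P Q : A.Obj} (f : P ⟶ Q) : hA.freeObj P ⟶ hA.freeObj Q :=
  ⟨freeMap f.hom (hA.isFlat f), hA.free_map f.hom _ P.mem Q.mem f.mem⟩

/-- The unit of the free geometric completion, as a 1-cell of `A`. -/
def unit (hA : RestrictsFree A) (P : A.Obj) : P ⟶ hA.freeObj P :=
  ⟨freeUnit P.of, hA.free_unit P.mem⟩

/-- The multiplication of the free geometric completion, as a 1-cell of `A`. -/
def mult (hA : RestrictsFree A) (P : A.Obj) : hA.freeObj (hA.freeObj P) ⟶ hA.freeObj P :=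
  ⟨freeMult P.of, hA.free_mult P.mem⟩

end RestrictsFree

/-- The conditions on a choice of subdoctrines `H P : TP ↪ free P`, for `P` in `A`, that make `T`
a pointed endofunctor of `A`. -/
structure IsNaturalChoice (hA : RestrictsFree A) (T : ∀ P : A.Obj, Subdoctrine (free P.of)) :
    Prop where
  /-- `TP` is an `A`-doctrine. -/
  obj_mem : ∀ P : A.Obj, A.obj (T P).toDoctrine
  /-- The inclusion `H P : TP ⟶ free P` is a morphism of `A`-doctrines. -/
  incl_mem : ∀ P : A.Obj, A.hom (T P).incl
  /-- The unit of the free geometric completion factors through `TP`. -/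
  unit_mem : ∀ (P : A.Obj) (c : P.of.base) (x : P.of.fibre c),
    (freeUnit P.of).app c x ∈ (T P).carrier c
  /-- The factorisation `P ⟶ TP` is a morphism of `A`-doctrines. -/
  unit_hom : ∀ P : A.Obj, A.hom ((T P).lift (freeUnit P.of) (unit_mem P))
  /-- For every morphism `f : P ⟶ Q` of `A`-doctrines, `free f` takes `TP` to `TQ`. -/
  map_mem : ∀ {P Q : A.Obj} (f : P ⟶ Q) (c : P.of.base) (x : (T P).toDoctrine.fibre c),
    ((T P).incl ≫ (hA.map f).hom).app c x ∈ (T Q).carrier (f.hom.functor.obj c)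
  /-- The restriction `TP ⟶ TQ` of `free f` is a morphism of `A`-doctrines. -/
  map_hom : ∀ {P Q : A.Obj} (f : P ⟶ Q),
    A.hom ((T Q).lift ((T P).incl ≫ (hA.map f).hom) (map_mem f))

namespace IsNaturalChoice

variable {hA : RestrictsFree A} {T : ∀ P : A.Obj, Subdoctrine (free P.of)}

/-- `TP`, as an `A`-doctrine. -/
def obj (h : IsNaturalChoice hA T) (P : A.Obj) : A.Obj := ⟨(T P).toDoctrine, h.obj_mem P⟩

/-- The inclusion `H P : TP ⟶ free P`, as a 1-cell of `A`. -/
def incl (h : IsNaturalChoice hA T) (P : A.Obj) : h.obj P ⟶ hA.freeObj P :=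
  ⟨(T P).incl, h.incl_mem P⟩

/-- The unit `P ⟶ TP`. -/
def unit (h : IsNaturalChoice hA T) (P : A.Obj) : P ⟶ h.obj P :=
  ⟨(T P).lift (freeUnit P.of) (h.unit_mem P), h.unit_hom P⟩

/-- `T f : TP ⟶ TQ`, the restriction of `free f`. -/
def map (h : IsNaturalChoice hA T) {P Q : A.Obj} (f : P ⟶ Q) : h.obj P ⟶ h.obj Q :=
  ⟨(T Q).lift ((T P).incl ≫ (hA.map f).hom) (h.map_mem f), h.map_hom f⟩

/-- The composite `TTP ⟶ T (free P) ⟶ free (free P) ⟶ free P` of `T (H P)`, `H (free P)` and the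
multiplication of the free geometric completion. -/
def preMult (h : IsNaturalChoice hA T) (P : A.Obj) : h.obj (h.obj P) ⟶ hA.freeObj P :=
  h.map (h.incl P) ≫ h.incl (hA.freeObj P) ≫ hA.mult P

end IsNaturalChoice

/-- A choice of subdoctrines `H P : TP ↪ free P`, for `P` in `A`, is `A`-compatible: it contains
the unit, is natural in `P`, and is closed under the multiplication of the free geometric
completion, all the induced morphisms being morphisms of `A`-doctrines. -/
structure IsCompatible (hA : RestrictsFree A) (T : ∀ P : A.Obj, Subdoctrine (free P.of)) : Prop
    extends IsNaturalChoice hA T where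
  /-- `TTP ⟶ free P` factors through `TP`. -/
  mult_mem : ∀ (P : A.Obj) (c : P.of.base)
    (x : (toIsNaturalChoice.obj (toIsNaturalChoice.obj P)).of.fibre c),
    (toIsNaturalChoice.preMult P).hom.app c x ∈ (T P).carrier c
  /-- The factorisation `TTP ⟶ TP` is a morphism of `A`-doctrines. -/
  mult_hom : ∀ P : A.Obj, A.hom ((T P).lift (toIsNaturalChoice.preMult P).hom (mult_mem P))

namespace IsCompatible

variable {hA : RestrictsFree A} {T : ∀ P : A.Obj, Subdoctrine (free P.of)}

/-- The multiplication `TTP ⟶ TP`. -/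
def mult (h : IsCompatible hA T) (P : A.Obj) : h.obj (h.obj P) ⟶ h.obj P :=
  ⟨(T P).lift (h.preMult P).hom (h.mult_mem P), h.mult_hom P⟩

variable (h : IsCompatible hA T)

theorem incl_mono {P Q : A.Obj} {f g : Q ⟶ h.obj P} (e : f ≫ h.incl P = g ≫ h.incl P) : f = g :=
  Sub2Category.hom_ext ((T P).incl_mono (congrArg Sub2Category.Hom.hom e))

theorem unit_incl (P : A.Obj) : h.unit P ≫ h.incl P = hA.unit P := rfl

theorem map_incl {P Q : A.Obj} (f : P ⟶ Q) : h.map f ≫ h.incl Q = h.incl P ≫ hA.map f := rfl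

theorem map_incl' {P Q R : A.Obj} (f : P ⟶ Q) (k : hA.freeObj Q ⟶ R) :
    h.map f ≫ h.incl Q ≫ k = h.incl P ≫ hA.map f ≫ k := rfl

theorem mult_incl (P : A.Obj) :
    h.mult P ≫ h.incl P = h.map (h.incl P) ≫ h.incl (hA.freeObj P) ≫ hA.mult P := rfl

theorem mult_incl' (P : A.Obj) {R : A.Obj} (k : hA.freeObj P ⟶ R) :
    h.mult P ≫ h.incl P ≫ k =
      h.map (h.incl P) ≫ h.incl (hA.freeObj P) ≫ hA.mult P ≫ k := rfl

theorem free_map_comp {P Q R : A.Obj} (f : P ⟶ Q) (g : Q ⟶ R) :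
    hA.map (f ≫ g) = hA.map f ≫ hA.map g :=
  Sub2Category.hom_ext
    (freeMap_comp f.hom g.hom (hA.isFlat f) (hA.isFlat g) (hA.isFlat (f ≫ g)))

theorem map_id (P : A.Obj) : h.map (𝟙 P) = 𝟙 (h.obj P) :=
  h.incl_mono <| by
    have e : hA.map (𝟙 P) = 𝟙 (hA.freeObj P) :=
      Sub2Category.hom_ext (freeMap_id P.of (hA.isFlat (𝟙 P)))
    rw [h.map_incl, e, Category.comp_id, Category.id_comp]

theorem map_comp {P Q R : A.Obj} (f : P ⟶ Q) (g : Q ⟶ R) :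
    h.map (f ≫ g) = h.map f ≫ h.map g :=
  h.incl_mono <| by
    rw [h.map_incl, free_map_comp, Category.assoc, h.map_incl, h.map_incl']

theorem unit_natural {P Q : A.Obj} (f : P ⟶ Q) : f ≫ h.unit Q = h.unit P ≫ h.map f :=
  h.incl_mono <| by
    rw [Category.assoc, h.unit_incl, Category.assoc, h.map_incl, ← Category.assoc (h.unit P),
      h.unit_incl]
    exact Sub2Category.hom_ext (freeUnit_natural f.hom (hA.isFlat f))

theorem mult_natural {P Q : A.Obj} (f : P ⟶ Q) :
    h.map (h.map f) ≫ h.mult Q = h.mult P ≫ h.map f :=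
  h.incl_mono <| by
    have e : hA.map (hA.map f) ≫ hA.mult Q = hA.mult P ≫ hA.map f :=
      Sub2Category.hom_ext (freeMult_natural f.hom (hA.isFlat f) (hA.isFlat (hA.map f)))
    rw [Category.assoc, h.mult_incl, ← Category.assoc, ← h.map_comp, h.map_incl, h.map_comp,
      Category.assoc, h.map_incl', e, Category.assoc, h.map_incl, h.mult_incl']

theorem assoc (P : A.Obj) : h.map (h.mult P) ≫ h.mult P = h.mult (h.obj P) ≫ h.mult P :=
  h.incl_mono <| by
    have e : hA.map (hA.mult P) ≫ hA.mult P = hA.mult (hA.freeObj P) ≫ hA.mult P :=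
      Sub2Category.hom_ext (freeMult_assoc P.of (hA.isFlat (hA.mult P)))
    rw [Category.assoc, Category.assoc, h.mult_incl, ← Category.assoc, ← h.map_comp, h.mult_incl,
      h.map_comp, h.map_comp, Category.assoc, Category.assoc, h.map_incl', e, ← h.mult_incl',
      ← Category.assoc (h.mult (h.obj P)), ← h.mult_natural, Category.assoc]

theorem left_unit (P : A.Obj) : h.unit (h.obj P) ≫ h.mult P = 𝟙 (h.obj P) :=
  h.incl_mono <| by
    have e : hA.unit (hA.freeObj P) ≫ hA.mult P = 𝟙 (hA.freeObj P) :=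
      Sub2Category.hom_ext (freeMult_left_unit P.of)
    rw [Category.assoc, h.mult_incl, ← Category.assoc, ← h.unit_natural, Category.assoc,
      ← Category.assoc (h.unit _), h.unit_incl, e, Category.comp_id, Category.id_comp]

theorem right_unit (P : A.Obj) : h.map (h.unit P) ≫ h.mult P = 𝟙 (h.obj P) :=
  h.incl_mono <| by
    have e : hA.map (hA.unit P) ≫ hA.mult P = 𝟙 (hA.freeObj P) :=
      Sub2Category.hom_ext (freeMult_right_unit P.of (hA.isFlat (hA.unit P)))
    rw [Category.assoc, h.mult_incl, ← Category.assoc, ← h.map_comp, h.unit_incl, h.map_incl', e,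
      Category.comp_id, Category.id_comp]

/-- The underlying natural transformation of a 2-cell of `A`. -/
def nat {X Y : A.Obj} {f g : X ⟶ Y} (α : f ⟶ g) : f.hom.functor ⟶ g.hom.functor :=
  Hom₂.nat (show f.hom ⟶ g.hom from α)

theorem cell_ext {X Y : A.Obj} {f g : X ⟶ Y} {α β : f ⟶ g}
    (e : ∀ c, (nat α).app c = (nat β).app c) : α = β :=
  hom₂_ext (NatTrans.ext (funext e))

theorem cell_sandwich {X Y : A.Obj} {f f' g g' : X ⟶ Y} (e : f = f') (e' : g' = g) (α : f ⟶ g)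
    (β : f' ⟶ g') (w : ∀ c, HEq ((nat α).app c) ((nat β).app c)) :
    α = eqToHom e ≫ β ≫ eqToHom e' := by
  cases e
  cases e'
  rw [eqToHom_refl, eqToHom_refl, Category.comp_id, Category.id_comp]
  exact cell_ext fun c => eq_of_heq (w c)

/-- `T` on 2-cells: the same natural transformation. -/
def map₂ {P Q : A.Obj} {f g : P ⟶ Q} (α : f ⟶ g) : h.map f ⟶ h.map g :=
  Hom₂.mk (P := (T P).toDoctrine) (Q := (T Q).toDoctrine) (f := (h.map f).hom)
    (g := (h.map g).hom) (nat (f := f) (g := g) α)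
    (fun c x => freeMap_le₂ (hA.isFlat f) (hA.isFlat g) (show f.hom ⟶ g.hom from α) c x.1)

/-- The 2-functor `T`. -/
def functor : StrictPseudofunctor A.Obj A.Obj :=
  StrictPseudofunctor.mk''
    { obj := h.obj
      map := h.map
      map₂ := h.map₂
      map₂_id := fun _ => rfl
      map₂_comp := fun _ _ => rfl
      map_id := h.map_id
      map_comp := h.map_comp
      map₂_whisker_left := fun f g g' η => cell_sandwich _ _ _ _ fun c => HEq.rfl
      map₂_whisker_right := fun η g => cell_sandwich _ _ _ _ fun c => HEq.rfl }

/-- The 2-monad given by a compatible choice of subdoctrines: the **compatible subcompletion**. -/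
def monad : TwoMonad A.Obj where
  T := h.functor
  unit := h.unit
  mult := h.mult
  unit_natural := h.unit_natural
  unit_natural₂ θ := cell_sandwich _ _ _ _ fun c => HEq.rfl
  mult_natural := h.mult_natural
  mult_natural₂ θ := cell_sandwich _ _ _ _ fun c => HEq.rfl
  assoc := h.assoc
  left_unit := h.left_unit
  right_unit := h.right_unit

end IsCompatible

/-! ### Primary doctrines -/

/-- A monotone map preserves finite meets. -/
def PreservesMeets {X Y : Type*} [Preorder X] [Preorder Y] (f : X →o Y) : Prop :=
  (∀ t : X, IsTop t → IsTop (f t)) ∧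
    ∀ x y z : X, IsGLB {x, y} z → IsGLB {f x, f y} (f z)

/-- A primary doctrine: the base is finitely complete, the fibres are meet-semilattices (posets
with all finite meets) and reindexing preserves finite meets. -/
structure IsPrimary (P : Doctrine.{w, v, u}) : Prop where
  finite_limits : Limits.HasFiniteLimits P.base
  antisymm : ∀ (c : P.base) (x y : P.fibre c), x ≤ y → y ≤ x → x = y
  top : ∀ c : P.base, ∃ t : P.fibre c, IsTop t
  meet : ∀ (c : P.base) (x y : P.fibre c), ∃ z, IsGLB {x, y} z
  re_meets : ∀ ⦃c d : P.base⦄ (f : d ⟶ c), PreservesMeets (P.re f)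

/-- The 2-category **PrimDoc** of primary doctrines: the 1-cells are the morphisms `(F, a)` where
`F` preserves finite limits and the components of `a` preserve finite meets. -/
def primDoc : Sub2Category Doctrine.{w, v, u} where
  obj := IsPrimary
  hom {P Q} f := Limits.PreservesFiniteLimits f.functor ∧ ∀ c : P.base, PreservesMeets (f.app c)
  id_mem _ := ⟨inferInstanceAs (Limits.PreservesFiniteLimits (𝟭 _)),
    fun _ => ⟨fun _ h => h, fun _ _ _ h => h⟩⟩
  comp_mem {P Q R} _ _ _ {f g} hf hg := by
    have h₁ := hf.1
    have h₂ := hg.1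
    exact ⟨Limits.comp_preservesFiniteLimits f.functor g.functor, fun c =>
      ⟨fun t ht => (hg.2 _).1 _ ((hf.2 c).1 t ht),
        fun x y z hz => (hg.2 _).2 _ _ _ ((hf.2 c).2 x y z hz)⟩⟩

/-! ### Supercompact and compact elements -/

/-- Every covering family of `X` contains a covering family with a single member. -/
def IsSupercompactObj {C : Type*} [Category C] (K : GrothendieckTopology C) (X : C) : Prop :=
  ∀ R : Presieve X, Sieve.generate R ∈ K X →
    ∃ (Y : C) (f : Y ⟶ X), R f ∧ Sieve.generate (Presieve.singleton f) ∈ K X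

/-- Every covering family of `X` contains a finite covering family. -/
def IsCompactObj {C : Type*} [Category C] (K : GrothendieckTopology C) (X : C) : Prop :=
  ∀ R : Presieve X, Sieve.generate R ∈ K X →
    ∃ R' : Presieve X, R' ≤ R ∧ {a : Σ Y : C, Y ⟶ X | R' a.2}.Finite ∧ Sieve.generate R' ∈ K X

/-- The supercompact elements of the free geometric completion: `(c, S)` is supercompact for the
topology `K`. -/
def IsSupercompact {c : P.base} (S : FreeElt P c) : Prop :=
  IsSupercompactObj (joinTopology P) ⟨c, S⟩

/-- The compact elements of the free geometric completion. -/
def IsCompactElt {c : P.base} (S : FreeElt P c) : Prop :=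
  IsCompactObj (joinTopology P) ⟨c, S⟩

/-! ### The existential completion -/

/-- A pair `(f, x)` with `f : d ⟶ c` and `x ∈ P(d)`. -/
structure ExPair (P : Doctrine.{w, v, u}) (c : P.base) where
  dom : P.base
  arrow : dom ⟶ c
  elt : P.fibre dom

/-- `(g, y) ≤ (f, x)` if `g` factors as `h ≫ f` with `y ≤ P(h)(x)`. -/
instance (c : P.base) : Preorder (ExPair P c) where
  le b a := ∃ h : b.dom ⟶ a.dom, h ≫ a.arrow = b.arrow ∧ b.elt ≤ P.re h a.elt
  le_refl a := ⟨𝟙 _, Category.id_comp _, (P.re_id _).ge⟩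
  le_trans a b c := by
    rintro ⟨h, hh, hx⟩ ⟨k, hk, hy⟩
    refine ⟨h ≫ k, by rw [Category.assoc, hk, hh], ?_⟩
    rw [re_comp]
    exact hx.trans ((P.re h).monotone hy)

/-- A subdoctrine `T` of `free P` is the existential completion of `P`: sending the class of
`(f, x)` to `∃_f ↓x` is an isomorphism from the poset reflection of the pairs `(f, x)` over `c` to
`T(c)`, under which reindexing along `g` sends `(f, x)` to `(k, P(h)(x))`, where `k` and `h` are
the pullbacks of `f` along `g` and of `g` along `f`. -/
def IsExistentialCompletion (T : Subdoctrine (free P)) : Prop :=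
  ∃ e : ∀ c : P.base, Antisymmetrization (ExPair P c) (· ≤ ·) ≃o T.toDoctrine.fibre c,
    (∀ (c : P.base) (a : ExPair P c),
      (e c (toAntisymmetrization (· ≤ ·) a)).1 = FreeElt.ex a.arrow (FreeElt.principal a.elt)) ∧
    ∀ ⦃c c' d d' : P.base⦄ (f : d ⟶ c) (g : c' ⟶ c) (k : d' ⟶ c') (h : d' ⟶ d),
      IsPullback k h g f → ∀ x : P.fibre d,
        T.toDoctrine.re (c := c) (d := c') g (e c (toAntisymmetrization (· ≤ ·) ⟨d, f, x⟩)) =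
          e c' (toAntisymmetrization (· ≤ ·) ⟨d', k, P.re h x⟩)

end Doctrine

/-! The whole argument rests on a Yoneda principle: an arrow `(d, ↓x) ⟶ (c, S)` is the same thing as
a member `(g, x)` of `S`, and `S` is the union of the `∃_g ↓x` over its members. The principal
objects `(d, ↓x)`, which are the images of the objects of `C ⋊ P`, are therefore dense in `C ⋊ TP`
and in `C ⋊ free P`.

Sub-geometricity. Let a sieve on `(c, S)` cover when it contains the arrows given by all members of
`S`. The filtering conditions for a morphism of sites then need checking only at principal objects,
with no further refinement (`IsMorphismOfSites.of_dense`). For `ε` they are immediate. For `T θ`, a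
member of `Tθ(S)` is a member `(g, x)` of `S` together with an arrow of the category of elements
into the image of `x`, so flatness of `θ` supplies the witnesses. The algebra `ξ` is the
multiplication `μ` restricted along `H`: its laws are laws of `μ`, and its site conditions hold
because `(g, x) ∈ μ(U)` forces `(g, ↓x) ∈ U`.

Lax-idempotency. The 2-cell is the identity natural transformation, and its inequality says that
`Tε(S)` is contained in `↓S`. Since 2-cells are determined by their natural transformations, the
required equations hold componentwise.

Primary doctrines. Testing against the cover by principal objects shows that the supercompact
elements are the `∃_f ↓x` and the compact ones the finite unions of these (`isSupercompact_iff`,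
`isCompactElt_iff`). Both are unions of families of bounded size, for a notion of size that contains
singletons and is closed under unions (`IsSizeClass`). Such unions are stable under reindexing by
the Beck–Chevalley formula for pullbacks, under intersection by pullbacks together with meets in the
fibres, and under `μ` by flattening a union of unions. Finite meets in `TP` are hence those of `free
P`, so every induced morphism is a 1-cell of primary doctrines (`IsSizeClass.isCompatible`). -/

/-! ### Morphisms of sites tested on a dense class, and flat functors -/

/-- An arrow `h` of the covering sieve factors as `m ≫ j` through a dense object. The data are
restricted along `j`, the problem is solved exactly there, and the solution is precomposed with `m`.
-/
theorem IsMorphismOfSites.of_dense {C : Type*} [Category C] {D : Type*} [Category D]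
    {J : GrothendieckTopology C} {K : GrothendieckTopology D} {F : C ⥤ D} (dense : D → Prop)
    (hdense : ∀ d : D, ∃ R ∈ K d, ∀ ⦃e : D⦄ (h : e ⟶ d), R h →
      ∃ (e' : D) (_ : dense e') (m : e ⟶ e') (j : e' ⟶ d), m ≫ j = h)
    (cover : ∀ ⦃c : C⦄ (S : Sieve c), S ∈ J c → S.functorPushforward F ∈ K (F.obj c))
    (inhabited : ∀ d : D, dense d → ∃ c : C, Nonempty (d ⟶ F.obj c))
    (pair : ∀ ⦃c₁ c₂ : C⦄ ⦃d : D⦄, dense d → ∀ (g₁ : d ⟶ F.obj c₁) (g₂ : d ⟶ F.obj c₂),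
      ∃ (c : C) (f₁ : c ⟶ c₁) (f₂ : c ⟶ c₂) (k : d ⟶ F.obj c),
        k ≫ F.map f₁ = g₁ ∧ k ≫ F.map f₂ = g₂)
    (parallel : ∀ ⦃c' c : C⦄ (f₁ f₂ : c' ⟶ c) ⦃d : D⦄, dense d → ∀ g : d ⟶ F.obj c',
      g ≫ F.map f₁ = g ≫ F.map f₂ →
      ∃ (c'' : C) (l : c'' ⟶ c') (k : d ⟶ F.obj c''), l ≫ f₁ = l ≫ f₂ ∧ k ≫ F.map l = g) :
    IsMorphismOfSites J K F where
  cover := cover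
  inhabited d := by
    obtain ⟨R, hR, H⟩ := hdense d
    refine ⟨R, hR, fun e h hh => ?_⟩
    obtain ⟨e', he', m, j, rfl⟩ := H h hh
    obtain ⟨c, ⟨k⟩⟩ := inhabited e' he'
    exact ⟨c, ⟨m ≫ k⟩⟩
  pair c₁ c₂ d g₁ g₂ := by
    obtain ⟨R, hR, H⟩ := hdense d
    refine ⟨R, hR, fun e h hh => ?_⟩
    obtain ⟨e', he', m, j, rfl⟩ := H h hh
    obtain ⟨c, f₁, f₂, k, h₁, h₂⟩ := pair he' (j ≫ g₁) (j ≫ g₂)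
    exact ⟨c, f₁, f₂, m ≫ k, by simp [h₁], by simp [h₂]⟩
  parallel c' c f₁ f₂ d g w := by
    obtain ⟨R, hR, H⟩ := hdense d
    refine ⟨R, hR, fun e h hh => ?_⟩
    obtain ⟨e', he', m, j, rfl⟩ := H h hh
    obtain ⟨c'', l, k, h₁, h₂⟩ := parallel f₁ f₂ he' (j ≫ g) (by simp [w])
    exact ⟨c'', l, m ≫ k, h₁, by simp [h₂]⟩

theorem functorPushforward_mem_of_bot {C : Type*} [Category C] {D : Type*} [Category D]
    (K : GrothendieckTopology D) (F : C ⥤ D) ⦃c : C⦄ (S : Sieve c)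
    (hS : S ∈ (⊥ : GrothendieckTopology C) c) : S.functorPushforward F ∈ K (F.obj c) := by
  rw [GrothendieckTopology.bot_covering] at hS
  subst hS
  rw [Sieve.functorPushforward_top]
  exact K.top_mem _

theorem IsMorphismOfSites.of_trivial {C : Type*} [Category C] {D : Type*} [Category D]
    {F : C ⥤ D} (inhabited : ∀ d : D, ∃ c : C, Nonempty (d ⟶ F.obj c))
    (pair : ∀ ⦃c₁ c₂ : C⦄ ⦃d : D⦄ (g₁ : d ⟶ F.obj c₁) (g₂ : d ⟶ F.obj c₂),
      ∃ (c : C) (f₁ : c ⟶ c₁) (f₂ : c ⟶ c₂) (k : d ⟶ F.obj c),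
        k ≫ F.map f₁ = g₁ ∧ k ≫ F.map f₂ = g₂)
    (parallel : ∀ ⦃c' c : C⦄ (f₁ f₂ : c' ⟶ c) ⦃d : D⦄ (g : d ⟶ F.obj c'),
      g ≫ F.map f₁ = g ≫ F.map f₂ →
      ∃ (c'' : C) (l : c'' ⟶ c') (k : d ⟶ F.obj c''), l ≫ f₁ = l ≫ f₂ ∧ k ≫ F.map l = g) :
    IsMorphismOfSites (⊥ : GrothendieckTopology C) (⊥ : GrothendieckTopology D) F :=
  .of_dense (fun _ => True)
    (fun d => ⟨⊤, GrothendieckTopology.top_mem _ _,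
      fun e h _ => ⟨e, trivial, 𝟙 e, h, Category.id_comp h⟩⟩)
    (functorPushforward_mem_of_bot _ F) (fun d _ => inhabited d) (fun _ _ _ _ => @pair _ _ _)
    (fun _ _ f₁ f₂ _ _ => parallel f₁ f₂ (d := _))

namespace IsMorphismOfSites

variable {C : Type*} [Category C] {D : Type*} [Category D] {J : GrothendieckTopology C} {F : C ⥤ D}

/-- Over the trivial topology the covering sieve in each filtering condition is maximal, so the
condition can be read at the identity; the same applies to `exists_span` and `exists_fork`. -/
theorem exists_hom (hF : IsMorphismOfSites J (⊥ : GrothendieckTopology D) F) (d : D) :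
    ∃ c : C, Nonempty (d ⟶ F.obj c) := by
  obtain ⟨R, hR, H⟩ := hF.inhabited d
  rw [GrothendieckTopology.bot_covering] at hR
  exact H (𝟙 d) (by rw [hR]; trivial)

theorem exists_span (hF : IsMorphismOfSites J (⊥ : GrothendieckTopology D) F) {c₁ c₂ : C} {d : D}
    (g₁ : d ⟶ F.obj c₁) (g₂ : d ⟶ F.obj c₂) :
    ∃ (c : C) (f₁ : c ⟶ c₁) (f₂ : c ⟶ c₂) (k : d ⟶ F.obj c),
      k ≫ F.map f₁ = g₁ ∧ k ≫ F.map f₂ = g₂ := by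
  obtain ⟨R, hR, H⟩ := hF.pair g₁ g₂
  rw [GrothendieckTopology.bot_covering] at hR
  simpa using H (𝟙 d) (by rw [hR]; trivial)

theorem exists_fork (hF : IsMorphismOfSites J (⊥ : GrothendieckTopology D) F) {c' c : C}
    (f₁ f₂ : c' ⟶ c) {d : D} (g : d ⟶ F.obj c') (w : g ≫ F.map f₁ = g ≫ F.map f₂) :
    ∃ (c'' : C) (l : c'' ⟶ c') (k : d ⟶ F.obj c''), l ≫ f₁ = l ≫ f₂ ∧ k ≫ F.map l = g := by
  obtain ⟨R, hR, H⟩ := hF.parallel f₁ f₂ g w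
  rw [GrothendieckTopology.bot_covering] at hR
  simpa using H (𝟙 d) (by rw [hR]; trivial)

end IsMorphismOfSites

theorem isFlatFunctor_id (C : Type*) [Category C] : IsFlatFunctor (𝟭 C) :=
  .of_trivial (fun d => ⟨d, ⟨𝟙 d⟩⟩)
    (fun _ _ d g₁ g₂ => ⟨d, g₁, g₂, 𝟙 d, Category.id_comp _, Category.id_comp _⟩)
    (fun _ _ _ _ d g w => ⟨d, g, 𝟙 d, w, Category.id_comp _⟩)

namespace Doctrine

variable {P Q : Doctrine.{w, v, u}}

/-! ### The topology on the elements of a subdoctrine, and density of principal objects -/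

namespace Subdoctrine

variable (T : Subdoctrine (free P))
  (hT : ∀ (c : P.base) (x : P.fibre c), (FreeElt.principal x : FreeElt P c) ∈ T.carrier c)

/-- The object `(d, ↓x)` of `C ⋊ T`. -/
abbrev principalObj {d : P.base} (x : P.fibre d) : T.toDoctrine.Total :=
  ⟨d, ⟨FreeElt.principal x, hT d x⟩⟩

/-- The element `S` of the free geometric completion underlying an object `(c, S)` of `C ⋊ T`. -/
abbrev eltOf (X : T.toDoctrine.Total) : FreeElt P X.pt := X.elt.1

/-- The arrow `(d, ↓x) ⟶ (c, S)` given by a member `(g, x)` of `S`. -/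
def principalHom (X : T.toDoctrine.Total) {d : P.base} (g : d ⟶ X.pt) (x : P.fibre d)
    (hx : (T.eltOf X).mem g x) : T.principalObj hT x ⟶ X :=
  Total.Hom.mk g (by
    refine (FreeElt.principal_le_iff x (FreeElt.pull g (T.eltOf X))).2 ?_
    change (T.eltOf X).mem (𝟙 d ≫ g) x
    rwa [Category.id_comp])

/-- The topology on `C ⋊ T` induced by the topology `K` on `C ⋊ free P`: `R` covers `(c, S)` if
it contains all the arrows `(d, ↓x) ⟶ (c, S)` given by the members `(g, x)` of `S`. -/
def topology : GrothendieckTopology T.toDoctrine.Total where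
  sieves X := {R : Sieve X | ∀ (d : P.base) (g : d ⟶ X.pt) (x : P.fibre d)
    (hx : (T.eltOf X).mem g x), R (T.principalHom hT X g x hx)}
  top_mem' X _ _ _ _ := trivial
  pullback_stable' X Y R k hR d g x hx := hR d (g ≫ k.arrow) x (k.elt_le g x hx)
  transitive' X R hR R' hR' d g x hx := by
    -- A cover of `(d, ↓x)` contains the arrow given by the generic member `(𝟙 d, x)`, which is the
    -- identity; so the pullback of `R'` along the arrow of `(g, x)` is maximal.
    have := hR' (hR d g x hx) d (𝟙 d) x (P.re_id x).ge
    have e : T.principalHom hT (T.principalObj hT x) (𝟙 d) x (P.re_id x).ge ≫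
        T.principalHom hT X g x hx = T.principalHom hT X g x hx :=
      Total.Hom.ext (Category.id_comp g)
    rw [Sieve.pullback_apply, e] at this
    exact this

theorem topology_dense (X : T.toDoctrine.Total) :
    ∃ R ∈ T.topology hT X, ∀ ⦃Y : T.toDoctrine.Total⦄ (h : Y ⟶ X), R h →
      ∃ (Y' : T.toDoctrine.Total)
        (_ : ∃ (d : P.base) (x : P.fibre d), Y' = T.principalObj hT x)
        (m : Y ⟶ Y') (j : Y' ⟶ X), m ≫ j = h := by
  -- The predicate of the sieve is left to unification with the last component: it is the property
  -- of factoring through a principal object.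
  refine ⟨⟨fun Y h => _, ?_⟩, ?_, fun Y h hh => hh⟩
  · rintro Y Z _ ⟨Y', hY', m, j, rfl⟩ g
    exact ⟨Y', hY', g ≫ m, j, Category.assoc _ _ _⟩
  · intro d g x hx
    exact ⟨_, ⟨d, x, rfl⟩, 𝟙 _, T.principalHom hT X g x hx, Category.id_comp _⟩

/-- It suffices that `R` hits every member of `X`: if `(g, x)` comes from a member `(k, x)` of `Y`,
its arrow factors through `Y ⟶ X` by the arrow of `(k, x)`. -/
theorem mem_topology_of_forall {X : T.toDoctrine.Total} {R : Sieve X}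
    (h : ∀ (d : P.base) (g : d ⟶ X.pt) (x : P.fibre d), (T.eltOf X).mem g x →
      ∃ (Y : T.toDoctrine.Total) (f : Y ⟶ X), R f ∧
        ∃ k : d ⟶ Y.pt, (T.eltOf Y).mem k x ∧ k ≫ f.arrow = g) :
    R ∈ T.topology hT X := by
  intro d g x hx
  obtain ⟨Y, f, hf, k, hk, rfl⟩ := h d g x hx
  exact R.downward_closed hf (T.principalHom hT Y k x hk)

/-- A principal object maps to `(c, S)` along `g` only if `(g, x)` belongs to `S`. -/
theorem mem_of_principalHom {X : T.toDoctrine.Total} {d : P.base} {x : P.fibre d}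
    (g : T.principalObj hT x ⟶ X) : (T.eltOf X).mem g.arrow x := by
  have := (FreeElt.principal_le_iff x (FreeElt.pull (P := P) g.arrow (T.eltOf X))).1 g.elt_le
  change (T.eltOf X).mem (𝟙 d ≫ g.arrow) x at this
  rwa [Category.id_comp] at this

end Subdoctrine

/-- The object `(d, ↓x)` of `C ⋊ free P`. -/
abbrev principalObj {d : P.base} (x : P.fibre d) : (free P).Total :=
  ⟨d, (FreeElt.principal x : FreeElt P d)⟩

/-- The arrow `(d, ↓x) ⟶ (c, S)` given by a member `(g, x)` of `S`. -/
def principalHom (X : (free P).Total) {d : P.base} (g : d ⟶ X.pt) (x : P.fibre d)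
    (hx : FreeElt.mem (P := P) X.elt g x) : principalObj x ⟶ X :=
  Total.Hom.mk g (by
    refine (FreeElt.principal_le_iff x (FreeElt.pull (P := P) g X.elt)).2 ?_
    change FreeElt.mem (P := P) X.elt (𝟙 d ≫ g) x
    rwa [Category.id_comp])

/-- With `principalHom`, this is the Yoneda correspondence between arrows out of a principal object
and members. -/
theorem mem_of_principalHom {X : (free P).Total} {d : P.base} {x : P.fibre d}
    (g : principalObj x ⟶ X) : FreeElt.mem (P := P) X.elt g.arrow x := by
  have := (FreeElt.principal_le_iff x (FreeElt.pull (P := P) g.arrow X.elt)).1 g.elt_le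
  change FreeElt.mem (P := P) X.elt (𝟙 d ≫ g.arrow) x at this
  rwa [Category.id_comp] at this

/-- An element is the join of the `∃_g ↓x` over its own members `(g, x)`, so the arrows through
principal objects form a join cover. -/
theorem joinTopology_dense (X : (free P).Total) :
    ∃ R ∈ joinTopology P X, ∀ ⦃Y : (free P).Total⦄ (h : Y ⟶ X), R h →
      ∃ (Y' : (free P).Total) (_ : ∃ (d : P.base) (x : P.fibre d), Y' = principalObj x)
        (m : Y ⟶ Y') (j : Y' ⟶ X), m ≫ j = h := by
  refine ⟨⟨fun Y h => _, ?_⟩, ?_, fun Y h hh => hh⟩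
  · rintro Y Z _ ⟨Y', hY', m, j, rfl⟩ g
    exact ⟨Y', hY', g ≫ m, j, Category.assoc _ _ _⟩
  · refine (isJoinCover_iff _).2 fun d g x hx => ?_
    exact ⟨_, principalHom X g x hx,
      ⟨_, ⟨d, x, rfl⟩, 𝟙 _, principalHom X g x hx, Category.id_comp _⟩,
      𝟙 d, (P.re_id x).ge, Category.id_comp _⟩

/-! ### Sub-geometricity and lax-idempotency of compatible subcompletions -/

namespace IsCompatible

variable {A : Sub2Category Doctrine.{w, v, u}} {hA : RestrictsFree A}
  {T : ∀ P : A.Obj, Subdoctrine (free P.of)} (h : IsCompatible hA T)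

/-- The `T`-algebra structure on a free geometric completion. -/
def alg (P : A.Obj) : h.obj (hA.freeObj P) ⟶ hA.freeObj P :=
  h.incl (hA.freeObj P) ≫ hA.mult P

/-- This is the free algebra of the geometric completion restricted along `H`, which is compatible
with the units and multiplications; only the left unit and associativity laws of `μ` remain. -/
theorem isAlgebra_alg (P : A.Obj) : h.monad.IsAlgebra (h.alg P) := by
  constructor
  · change h.unit _ ≫ h.incl _ ≫ hA.mult P = _
    rw [← Category.assoc, h.unit_incl]
    exact Sub2Category.hom_ext (freeMult_left_unit P.of)
  · change h.map (h.incl _ ≫ hA.mult P) ≫ h.incl _ ≫ hA.mult P =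
      h.mult _ ≫ h.incl _ ≫ hA.mult P
    have e : hA.map (hA.mult P) ≫ hA.mult P = hA.mult (hA.freeObj P) ≫ hA.mult P :=
      Sub2Category.hom_ext (freeMult_assoc P.of (hA.isFlat (hA.mult P)))
    rw [h.map_comp, Category.assoc, h.map_incl', e, h.mult_incl']

/-- The topology on `C ⋊ TP`. -/
def topology (P : A.Obj) : GrothendieckTopology (T P).toDoctrine.Total :=
  (T P).topology (h.unit_mem P)

/-- A principal object is the image of `(d, x)`, and an arrow `(d, ↓x) ⟶ (c, ↓y)` is an arrow `(d,
x) ⟶ (c, y)`. Every filtering condition is thus witnessed by `(d, x)` itself. -/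
theorem isSiteHom_unit (P : A.Obj) :
    IsSiteHom (⊥ : GrothendieckTopology P.of.Total) (h.topology P) (h.unit P).hom := by
  refine ⟨isFlatFunctor_id _, .of_dense _ ((T P).topology_dense (h.unit_mem P))
    (functorPushforward_mem_of_bot _ _) ?_ ?_ ?_⟩
  · rintro _ ⟨d, x, rfl⟩
    exact ⟨⟨d, x⟩, ⟨𝟙 _⟩⟩
  · rintro c₁ c₂ _ ⟨d, x, rfl⟩ g₁ g₂
    exact ⟨⟨d, x⟩, Total.Hom.mk g₁.arrow ((T P).mem_of_principalHom (h.unit_mem P) g₁),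
      Total.Hom.mk g₂.arrow ((T P).mem_of_principalHom (h.unit_mem P) g₂), 𝟙 _,
      Total.Hom.ext (Category.id_comp _), Total.Hom.ext (Category.id_comp _)⟩
  · rintro c' c f₁ f₂ _ ⟨d, x, rfl⟩ g w
    have w' := congrArg Total.Hom.arrow w
    exact ⟨⟨d, x⟩, Total.Hom.mk g.arrow ((T P).mem_of_principalHom (h.unit_mem P) g), 𝟙 _,
      Total.Hom.ext w', Total.Hom.ext (Category.id_comp _)⟩

/-- Each member of `Tθ(S)` lies below the image of some member `(g, x)` of `S`, so images of covers
cover. For the filtering conditions, an arrow `(e, ↓y) ⟶ Tθ(S)` unpacks into such a `(g, x)` and an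
arrow from `(e, y)` to the image of `x`, to which flatness of `θ` applies. -/
theorem isSiteHom_map {P Q : A.Obj} (θ : P ⟶ Q) :
    IsSiteHom (h.topology P) (h.topology Q) (h.map θ).hom := by
  have hθ := hA.isFlat θ
  refine ⟨hθ.1, .of_dense _ ((T Q).topology_dense (h.unit_mem Q)) ?_ ?_ ?_ ?_⟩
  · intro X S hS
    refine (T Q).mem_topology_of_forall (h.unit_mem Q) ?_
    rintro e k y ⟨d, g, x, hx, m, hm, rfl⟩
    refine ⟨_, (totalMap (h.map θ).hom).map ((T P).principalHom (h.unit_mem P) X g x hx),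
      ⟨_, _, 𝟙 _, hS d g x hx, (Category.id_comp _).symm⟩, m,
      ⟨d, 𝟙 d, x, (P.of.re_id x).ge, m, hm, ?_⟩, rfl⟩
    exact (congrArg (fun t => m ≫ t) (θ.hom.functor.map_id d)).trans (Category.comp_id m)
  · rintro _ ⟨d, y, rfl⟩
    obtain ⟨⟨c, x⟩, ⟨k⟩⟩ := hθ.2.exists_hom ⟨d, y⟩
    refine ⟨(T P).principalObj (h.unit_mem P) x, ⟨(T Q).principalHom (h.unit_mem Q) _ k.arrow y ?_⟩⟩
    exact ⟨c, 𝟙 c, x, (P.of.re_id x).ge, k.arrow, k.elt_le,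
      (congrArg (fun t => k.arrow ≫ t) (θ.hom.functor.map_id c)).trans (Category.comp_id _)⟩
  · rintro X₁ X₂ _ ⟨e, y, rfl⟩ g₁ g₂
    obtain ⟨d₁, m₁, x₁, hx₁, k₁, hk₁, w₁⟩ := (T Q).mem_of_principalHom (h.unit_mem Q) g₁
    obtain ⟨d₂, m₂, x₂, hx₂, k₂, hk₂, w₂⟩ := (T Q).mem_of_principalHom (h.unit_mem Q) g₂
    obtain ⟨⟨c, x⟩, f₁, f₂, k, e₁, e₂⟩ := hθ.2.exists_span (c₁ := ⟨d₁, x₁⟩) (c₂ := ⟨d₂, x₂⟩)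
      (d := ⟨e, y⟩) (Total.Hom.mk k₁ hk₁) (Total.Hom.mk k₂ hk₂)
    refine ⟨(T P).principalObj (h.unit_mem P) x,
      (T P).principalHom (h.unit_mem P) X₁ (f₁.arrow ≫ m₁) x
        (FreeElt.down _ m₁ x₁ f₁.arrow x hx₁ f₁.elt_le),
      (T P).principalHom (h.unit_mem P) X₂ (f₂.arrow ≫ m₂) x
        (FreeElt.down _ m₂ x₂ f₂.arrow x hx₂ f₂.elt_le),
      (T Q).principalHom (h.unit_mem Q) _ k.arrow y ?_, Total.Hom.ext ?_, Total.Hom.ext ?_⟩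
    · exact ⟨c, 𝟙 c, x, (P.of.re_id x).ge, k.arrow, k.elt_le,
        (congrArg (fun t => k.arrow ≫ t) (θ.hom.functor.map_id c)).trans (Category.comp_id _)⟩
    · exact (comp_map_comp θ.hom.functor (h := 𝟙 _) (n := k₁)
        ((congrArg Total.Hom.arrow e₁).trans (Category.id_comp _).symm) m₁).trans
          ((Category.id_comp _).trans w₁)
    · exact (comp_map_comp θ.hom.functor (h := 𝟙 _) (n := k₂)
        ((congrArg Total.Hom.arrow e₂).trans (Category.id_comp _).symm) m₂).trans
          ((Category.id_comp _).trans w₂)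
  · rintro X' X f₁ f₂ _ ⟨e, y, rfl⟩ g w
    obtain ⟨d, m, x, hx, k, hk, hw⟩ := (T Q).mem_of_principalHom (h.unit_mem Q) g
    have hw' : k ≫ θ.hom.functor.map (m ≫ f₁.arrow) = k ≫ θ.hom.functor.map (m ≫ f₂.arrow) := by
      exact (comp_map_comp θ.hom.functor (hw.trans (Category.id_comp g.arrow).symm) f₁.arrow).trans
        ((congrArg (𝟙 e ≫ ·) (congrArg Total.Hom.arrow w)).trans
          (comp_map_comp θ.hom.functor (hw.trans (Category.id_comp g.arrow).symm) f₂.arrow).symm)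
    -- Flatness of the base functor is enough here: the element over the equalizing object is taken
    -- to be the reindexing of `x` along `l`.
    obtain ⟨c, l, n, hl, rfl⟩ := hθ.1.exists_fork _ _ k hw'
    refine ⟨(T P).principalObj (h.unit_mem P) (P.of.re l x),
      (T P).principalHom (h.unit_mem P) X' (l ≫ m) _ (FreeElt.down _ m x l _ hx le_rfl),
      (T Q).principalHom (h.unit_mem Q) _ n y ?_, Total.Hom.ext ?_, Total.Hom.ext ?_⟩
    · refine ⟨c, 𝟙 c, _, (P.of.re_id _).ge, n, ?_,
        (congrArg (fun t => n ≫ t) (θ.hom.functor.map_id c)).trans (Category.comp_id _)⟩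
      change y ≤ Q.of.re n (θ.hom.app c (P.of.re l x))
      rw [Hom.app_re, ← re_comp]
      exact hk
    · exact (Category.assoc _ _ _).trans (hl.trans (Category.assoc _ _ _).symm)
    · exact (comp_map_comp θ.hom.functor (h := 𝟙 _) (n := n ≫ θ.hom.functor.map l)
        (Category.id_comp _).symm m).trans ((Category.id_comp _).trans hw)

theorem isSiteHom_alg (P : A.Obj) :
    IsSiteHom (h.topology (hA.freeObj P)) (joinTopology P.of) (h.alg P).hom := by
  -- If `(g, x)` lies in the join `μ(U)`, then `g = k ≫ m` with `(m, S) ∈ U` and `(k, x) ∈ S`; hence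
  -- `↓x ≤ k^* S`, and down-closure of `U` gives `(g, ↓x) ∈ U`.
  have key : ∀ {X : (T (hA.freeObj P)).toDoctrine.Total} {d : P.of.base} {x : P.of.fibre d}
      (g : principalObj x ⟶ (totalMap (h.alg P).hom).obj X),
      FreeElt.mem (P := free P.of) ((T (hA.freeObj P)).eltOf X) g.arrow
        (FreeElt.principal x : FreeElt P.of d) := by
    intro X d x g
    obtain ⟨b, m, S, hS, k, hk, w⟩ := mem_of_principalHom g
    have := FreeElt.down (P := free P.of) _ m S k (FreeElt.principal x : FreeElt P.of d) hS
      ((FreeElt.principal_le_iff x (FreeElt.pull (P := P.of) k S)).2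
        (show S.mem (𝟙 d ≫ k) x by rwa [Category.id_comp]))
    rwa [w] at this
  -- Since `μ(↓↓x) = ↓x`, the object `(d, ↓↓x)` serves as the universal witness for arrows out of
  -- `(d, ↓x)`; `ι` is the comparison arrow over the identity.
  let ι : ∀ {d : P.of.base} (x : P.of.fibre d), principalObj x ⟶
      (totalMap (h.alg P).hom).obj ((T (hA.freeObj P)).principalObj (h.unit_mem (hA.freeObj P))
        (d := d) (FreeElt.principal x : FreeElt P.of d)) :=
    fun {d} x => principalHom (P := P.of) ⟨d, _⟩ (𝟙 d) x
      ⟨d, 𝟙 d, FreeElt.principal x, ((free P.of).re_id (c := d) _).ge, 𝟙 d, (P.of.re_id x).ge,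
        Category.id_comp _⟩
  refine ⟨isFlatFunctor_id _, .of_dense _ joinTopology_dense ?_ ?_ ?_ ?_⟩
  · intro X R hR
    refine (isJoinCover_iff _).2 ?_
    rintro e k y ⟨d, g, S, hS, m, hm, rfl⟩
    refine ⟨_, (totalMap (h.alg P).hom).map
      ((T (hA.freeObj P)).principalHom (h.unit_mem (hA.freeObj P)) X g S hS),
      ⟨_, _, 𝟙 _, hR d g S hS, (Category.id_comp _).symm⟩, m, ?_, rfl⟩
    exact ⟨d, 𝟙 d, S, ((free P.of).re_id (c := d) _).ge, m, hm, Category.comp_id _⟩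
  · rintro _ ⟨d, x, rfl⟩
    exact ⟨(T (hA.freeObj P)).principalObj (h.unit_mem (hA.freeObj P))
      (d := d) (FreeElt.principal x : FreeElt P.of d), ⟨ι x⟩⟩
  · rintro X₁ X₂ _ ⟨d, x, rfl⟩ g₁ g₂
    exact ⟨(T (hA.freeObj P)).principalObj (h.unit_mem (hA.freeObj P))
        (d := d) (FreeElt.principal x : FreeElt P.of d),
      (T (hA.freeObj P)).principalHom (h.unit_mem (hA.freeObj P)) X₁ g₁.arrow _ (key g₁),
      (T (hA.freeObj P)).principalHom (h.unit_mem (hA.freeObj P)) X₂ g₂.arrow _ (key g₂),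
      ι x, Total.Hom.ext (Category.id_comp _),
      Total.Hom.ext (Category.id_comp _)⟩
  · rintro X' X f₁ f₂ _ ⟨d, x, rfl⟩ g w
    have w' := congrArg Total.Hom.arrow w
    exact ⟨(T (hA.freeObj P)).principalObj (h.unit_mem (hA.freeObj P))
        (d := d) (FreeElt.principal x : FreeElt P.of d),
      (T (hA.freeObj P)).principalHom (h.unit_mem (hA.freeObj P)) X' g.arrow _ (key g),
      ι x, Total.Hom.ext w',
      Total.Hom.ext (Category.id_comp _)⟩

theorem isSubGeometric : IsSubGeometric hA.toAdmitsFree h.monad :=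
  ⟨h.alg, h.isAlgebra_alg, h.topology, h.isSiteHom_unit, h.isSiteHom_alg, h.isSiteHom_map⟩

/-- The 2-cell `T ε ⟶ ε T`, given by the identity natural transformation. -/
def laxCell (P : A.Obj) : h.map (h.unit P) ⟶ h.unit (h.obj P) :=
  Hom₂.mk (P := (T P).toDoctrine) (Q := (T (h.obj P)).toDoctrine) (f := (h.map (h.unit P)).hom)
    (g := (h.unit (h.obj P)).hom) (𝟙 (𝟭 P.of.base)) (by
      intro c S
      rw [NatTrans.id_app]
      refine le_trans ?_ ((T (h.obj P)).toDoctrine.re_id (c := c) _).ge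
      -- A member of `Tε(S)` is some `(m ≫ g, V)` with `(g, x) ∈ S` and `V ≤ m^*(↓x)`. Every `(k, y)
      -- ∈ V` then has `y ≤ P(k ≫ m)(x)`, so down-closure of `S` gives `V ≤ (m ≫ g)^* S`, which is
      -- membership in `↓S`.
      rintro e _ V ⟨d, g, x, hx, m, hm, rfl⟩ b k y hy
      have hS := FreeElt.down (P := P.of) S.1 g x (k ≫ m) y hx (hm k y hy)
      exact (congrArg (fun t => FreeElt.mem (P := P.of) S.1 t y) (Category.assoc k m g)).mp hS)

/-- All the 2-cells compared have identity components, so `cell_sandwich` reduces each equation to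
components; naturality in `P` uses in addition that the base functor of `f` preserves identities. -/
theorem isLaxIdempotent : h.monad.IsLaxIdempotent := by
  refine ⟨h.laxCell, fun {P Q} f => ?_, fun P => ?_, fun P => ?_⟩
  · exact cell_sandwich _ _ _ _ fun c => heq_of_eq (f.hom.functor.map_id c).symm
  · refine (cell_sandwich (h.unit_natural (h.unit P)).symm rfl _ (𝟙 _) fun c => HEq.rfl).trans ?_
    rw [eqToHom_refl, Category.comp_id, Category.comp_id]
    rfl
  · refine (cell_sandwich ((h.right_unit P).trans (h.left_unit P).symm) rfl _ (𝟙 _)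
      fun c => HEq.rfl).trans ?_
    rw [eqToHom_refl, Category.comp_id, Category.comp_id]
    rfl

end IsCompatible

end Doctrine

/-! ### Primary doctrines and the free geometric completion -/

theorem IsFlatFunctor.of_preservesFiniteLimits {C : Type*} [Category C] {D : Type*} [Category D]
    [Limits.HasFiniteLimits C] (F : C ⥤ D) [Limits.PreservesFiniteLimits F] : IsFlatFunctor F := by
  refine .of_trivial (fun d => ?_) (fun c₁ c₂ d g₁ g₂ => ?_) (fun c' c f₁ f₂ d g w => ?_)
  · exact ⟨_, ⟨(Limits.IsTerminal.isTerminalObj F _ Limits.terminalIsTerminal).from d⟩⟩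
  · obtain ⟨k, h₁, h₂⟩ := Limits.BinaryFan.IsLimit.lift'
      (Limits.isLimitOfHasBinaryProductOfPreservesLimit F c₁ c₂) g₁ g₂
    exact ⟨_, Limits.prod.fst, Limits.prod.snd, k, h₁, h₂⟩
  · obtain ⟨k, hk⟩ := Limits.Fork.IsLimit.lift'
      (Limits.isLimitOfHasEqualizerOfPreservesLimit F f₁ f₂) g w
    exact ⟨_, Limits.equalizer.ι f₁ f₂, k, Limits.equalizer.condition f₁ f₂, hk⟩

namespace Doctrine

variable {P Q : Doctrine.{w, v, u}}

/-! ### Finite meets in the free geometric completion -/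

namespace FreeElt

/-- The greatest element of a fibre of the free geometric completion. -/
def total (P : Doctrine.{w, v, u}) (c : P.base) : FreeElt P c where
  mem _ _ _ := True
  down _ _ _ _ _ _ _ _ := trivial

/-- The intersection of two elements of the free geometric completion. -/
def inter {c : P.base} (S S' : FreeElt P c) : FreeElt P c where
  mem _ g x := S.mem g x ∧ S'.mem g x
  down _ _ f x g y hx hy := ⟨S.down f x g y hx.1 hy, S'.down f x g y hx.2 hy⟩

theorem isGLB_inter {c : P.base} (S S' : FreeElt P c) : IsGLB {S, S'} (inter S S') := by
  refine ⟨?_, fun V hV d g x hx => ⟨hV (.inl rfl) g x hx, hV (.inr rfl) g x hx⟩⟩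
  rintro _ (rfl | rfl) d g x hx
  exacts [hx.1, hx.2]

theorem isTop_iff {c : P.base} {S : FreeElt P c} :
    IsTop S ↔ ∀ (d : P.base) (g : d ⟶ c) (x : P.fibre d), S.mem g x :=
  ⟨fun h d g x => h (total P c) g x trivial, fun h _ d g x _ => h d g x⟩

theorem isGLB_iff {c : P.base} {S S' V : FreeElt P c} :
    IsGLB {S, S'} V ↔ V = inter S S' :=
  ⟨fun h => h.unique (isGLB_inter S S'), fun h => h ▸ isGLB_inter S S'⟩

/-- The union of the elements `∃_f ↓x`, for `(f, x) ∈ G`. -/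
def span {c : P.base} (G : Set (ExPair P c)) : FreeElt P c where
  mem _ k y := ∃ a ∈ G, (ex a.arrow (principal a.elt)).mem k y
  down := by
    rintro d e f x g y ⟨a, ha, h⟩ hy
    exact ⟨a, ha, FreeElt.down _ f x g y h hy⟩

theorem span_singleton {c : P.base} (a : ExPair P c) :
    span {a} = ex a.arrow (principal a.elt) := by
  refine le_antisymm ?_ ?_
  · rintro d k y ⟨_, rfl, h⟩
    exact h
  · exact fun d k y h => ⟨a, rfl, h⟩

theorem principal_eq_span {c : P.base} (x : P.fibre c) : principal x = span {⟨c, 𝟙 c, x⟩} := by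
  rw [span_singleton]
  refine le_antisymm (fun d g y hy => ⟨g, hy, Category.comp_id g⟩) ?_
  rintro d _ y ⟨g, hy, rfl⟩
  exact (congrArg (fun t => y ≤ P.re t x) (Category.comp_id g)).mpr hy

/-- Beck–Chevalley: a member over `m` of the left side is an `n` with `n ≫ f = m ≫ g`, that is, a
map into the pullback. -/
theorem pull_ex_principal {c c' d d' : P.base} {f : d ⟶ c} {g : c' ⟶ c} {k : d' ⟶ c'}
    {h : d' ⟶ d} (sq : IsPullback k h g f) (x : P.fibre d) :
    pull g (ex f (principal x)) = ex k (principal (P.re h x)) := by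
  refine le_antisymm ?_ ?_
  · rintro e m y ⟨n, hn, w⟩
    refine ⟨sq.lift m n w.symm, ?_, sq.lift_fst _ _ _⟩
    change y ≤ P.re _ (P.re h x)
    rw [← re_comp, sq.lift_snd]
    exact hn
  · rintro e _ y ⟨n, hn, rfl⟩
    refine ⟨n ≫ h, ?_, by rw [Category.assoc, Category.assoc, sq.w]⟩
    change y ≤ P.re _ x
    rw [re_comp]
    exact hn

/-- The action of a morphism preserves unions and takes the generator `∃_g ↓x` to the generator
`∃_{F g} ↓a(x)`. -/
theorem freeApp_span (f : P ⟶ Q) {c : P.base} (G : Set (ExPair P c)) :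
    freeApp f (span G) =
      span ((fun a => ⟨f.functor.obj a.dom, f.functor.map a.arrow, f.app a.dom a.elt⟩) '' G) := by
  refine le_antisymm ?_ ?_
  · rintro e _ y ⟨d, _, x, ⟨a, ha, g, hg, rfl⟩, m, hm, rfl⟩
    refine ⟨_, ⟨a, ha, rfl⟩, m ≫ f.functor.map g, ?_, by
      rw [f.functor.map_comp, Category.assoc]⟩
    change y ≤ Q.re (m ≫ f.functor.map g) (f.app a.dom a.elt)
    rw [re_comp, ← Hom.app_re]
    exact le_trans hm ((Q.re m).monotone ((f.app d).monotone hg))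
  · rintro e k y ⟨_, ⟨a, ha, rfl⟩, h⟩
    exact ⟨a.dom, a.arrow, a.elt, ⟨a, ha, 𝟙 _, (P.re_id _).ge, Category.id_comp _⟩, h⟩

end FreeElt

theorem IsPrimary.free (hP : IsPrimary P) : IsPrimary (free P) where
  finite_limits := hP.finite_limits
  antisymm c x y h h' := le_antisymm (α := FreeElt P c) h h'
  top c := ⟨FreeElt.total P c, FreeElt.isTop_iff.2 fun _ _ _ => trivial⟩
  meet c x y := ⟨FreeElt.inter (P := P) x y, FreeElt.isGLB_inter (P := P) x y⟩
  re_meets c d f := by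
    refine ⟨fun t ht => FreeElt.isTop_iff.2 fun e g x => FreeElt.isTop_iff.1 ht e (g ≫ f) x, ?_⟩
    intro x y z hz
    obtain rfl := (FreeElt.isGLB_iff (P := P)).1 hz
    exact FreeElt.isGLB_inter (P := P) (FreeElt.pull (P := P) f x) (FreeElt.pull (P := P) f y)

/-- The witnesses in the base come from flatness of the functor. The element put over them is the
top, the meet of the two reindexed elements, or the reindexed element; preservation of tops and
meets keeps the given arrow an arrow of elements. -/
theorem IsFlat.of_preservesMeets (hP : IsPrimary P) (hQ : IsPrimary Q) (f : P ⟶ Q)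
    (hF : IsFlatFunctor f.functor) (hf : ∀ c : P.base, PreservesMeets (f.app c)) : IsFlat f := by
  refine ⟨hF, .of_trivial ?_ ?_ ?_⟩
  · rintro ⟨d, y⟩
    obtain ⟨c, ⟨k⟩⟩ := hF.exists_hom d
    obtain ⟨t, ht⟩ := hP.top c
    exact ⟨⟨c, t⟩, ⟨Total.Hom.mk k ((hQ.re_meets k).1 _ ((hf c).1 t ht) y)⟩⟩
  · rintro ⟨c₁, x₁⟩ ⟨c₂, x₂⟩ ⟨d, y⟩ ⟨g₁, h₁⟩ ⟨g₂, h₂⟩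
    obtain ⟨c, f₁, f₂, k, rfl, rfl⟩ := hF.exists_span g₁ g₂
    obtain ⟨x, hx⟩ := hP.meet c (P.re f₁ x₁) (P.re f₂ x₂)
    refine ⟨⟨c, x⟩, Total.Hom.mk f₁ (hx.1 (.inl rfl)), Total.Hom.mk f₂ (hx.1 (.inr rfl)),
      Total.Hom.mk k (((hQ.re_meets k).2 _ _ _ ((hf c).2 _ _ _ hx)).2 ?_),
      Total.Hom.ext rfl, Total.Hom.ext rfl⟩
    rintro _ (rfl | rfl)
    · change y ≤ Q.re k (f.app c (P.re f₁ x₁))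
      rw [Hom.app_re, ← re_comp]
      exact h₁
    · change y ≤ Q.re k (f.app c (P.re f₂ x₂))
      rw [Hom.app_re, ← re_comp]
      exact h₂
  · rintro ⟨c', x'⟩ ⟨c, x⟩ f₁ f₂ ⟨d, y⟩ ⟨g, hg⟩ w
    obtain ⟨c'', l, k, hl, rfl⟩ := hF.exists_fork f₁.arrow f₂.arrow g (congrArg Total.Hom.arrow w)
    refine ⟨⟨c'', P.re l x'⟩, Total.Hom.mk l le_rfl, Total.Hom.mk k ?_, Total.Hom.ext hl,
      Total.Hom.ext rfl⟩
    change y ≤ Q.re k (f.app c'' (P.re l x'))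
    rw [Hom.app_re, ← re_comp]
    exact hg

theorem IsFlat.exists_span {f : P ⟶ Q} (hf : IsFlat f) {d₁ d₂ : P.base} {e : Q.base}
    {x₁ : P.fibre d₁} {x₂ : P.fibre d₂} {y : Q.fibre e} {m₁ : e ⟶ f.functor.obj d₁}
    {m₂ : e ⟶ f.functor.obj d₂} (h₁ : y ≤ Q.re m₁ (f.app d₁ x₁))
    (h₂ : y ≤ Q.re m₂ (f.app d₂ x₂)) :
    ∃ (b : P.base) (z : P.fibre b) (f₁ : b ⟶ d₁) (f₂ : b ⟶ d₂) (n : e ⟶ f.functor.obj b),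
      z ≤ P.re f₁ x₁ ∧ z ≤ P.re f₂ x₂ ∧ y ≤ Q.re n (f.app b z) ∧
        n ≫ f.functor.map f₁ = m₁ ∧ n ≫ f.functor.map f₂ = m₂ := by
  obtain ⟨⟨b, z⟩, f₁, f₂, n, e₁, e₂⟩ := hf.2.exists_span (c₁ := ⟨d₁, x₁⟩) (c₂ := ⟨d₂, x₂⟩)
    (d := ⟨e, y⟩) (Total.Hom.mk m₁ h₁) (Total.Hom.mk m₂ h₂)
  exact ⟨b, z, f₁.arrow, f₂.arrow, n.arrow, f₁.elt_le, f₂.elt_le, n.elt_le,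
    congrArg Total.Hom.arrow e₁, congrArg Total.Hom.arrow e₂⟩

theorem preservesMeets_freeMap (f : P ⟶ Q) (hf : IsFlat f) (c : P.base) :
    PreservesMeets ((freeMap f hf).app c) := by
  constructor
  · intro t ht
    refine FreeElt.isTop_iff.2 fun e k y => ?_
    obtain ⟨⟨c₀, x₀⟩, ⟨m⟩⟩ := hf.2.exists_hom ⟨e, y⟩
    -- The pair `(c₀, x₀)` dominates `y` but need not lie over `c`; the span puts it over `c`, by
    -- reindexing `x₀` along `f₂`.
    obtain ⟨c₁, f₁, f₂, n, rfl, hn⟩ := hf.1.exists_span (c₁ := c) (c₂ := c₀) k m.arrow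
    refine ⟨c₁, f₁, P.re f₂ x₀, FreeElt.isTop_iff.1 ht _ _ _, n, ?_, rfl⟩
    change y ≤ Q.re n (f.app c₁ (P.re f₂ x₀))
    rw [Hom.app_re, ← re_comp, hn]
    exact m.elt_le
  · intro S S' V hV
    obtain rfl := (FreeElt.isGLB_iff (P := P)).1 hV
    refine (FreeElt.isGLB_iff (P := Q)).2 (le_antisymm (α := FreeElt Q _) ?_ ?_)
    · rintro e k y ⟨d, g, x, hx, h⟩
      exact ⟨⟨d, g, x, hx.1, h⟩, ⟨d, g, x, hx.2, h⟩⟩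
    · rintro e k y ⟨⟨d₁, g₁, x₁, hx₁, m₁, hm₁, w₁⟩, ⟨d₂, g₂, x₂, hx₂, m₂, hm₂, w₂⟩⟩
      obtain ⟨b, z, f₁, f₂, n, h₁, h₂, hn, rfl, rfl⟩ := hf.exists_span hm₁ hm₂
      have w₁' : n ≫ f.functor.map (f₁ ≫ g₁) = k := by
        rw [f.functor.map_comp, ← Category.assoc, w₁]
      have w₂' : n ≫ f.functor.map (f₂ ≫ g₂) = k := by
        rw [f.functor.map_comp, ← Category.assoc, w₂]
      -- The two legs `f₁ ≫ g₁` and `f₂ ≫ g₂` agree only after applying `F` and precomposing with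
      -- `n`; equalizing them in the base yields one pair that lies in both `S` and `S'`.
      obtain ⟨b', l, p, hl, rfl⟩ := hf.1.exists_fork _ _ n (w₁'.trans w₂'.symm)
      refine ⟨b', l ≫ f₁ ≫ g₁, P.re l z, ⟨?_, ?_⟩, p, ?_, ?_⟩
      · exact FreeElt.down (P := P) S (f₁ ≫ g₁) z l _
          (FreeElt.down (P := P) S g₁ x₁ f₁ z hx₁ h₁) le_rfl
      · rw [hl]
        exact FreeElt.down (P := P) S' (f₂ ≫ g₂) z l _
          (FreeElt.down (P := P) S' g₂ x₂ f₂ z hx₂ h₂) le_rfl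
      · change y ≤ Q.re p (f.app b' (P.re l z))
        rw [Hom.app_re, ← re_comp]
        exact hn
      · rw [f.functor.map_comp, ← Category.assoc, w₁']

theorem preservesMeets_freeUnit (hP : IsPrimary P) (c : P.base) :
    PreservesMeets ((freeUnit P).app c) := by
  refine ⟨fun t ht => FreeElt.isTop_iff.2 fun d g x => (hP.re_meets g).1 t ht x, ?_⟩
  intro x y z hz
  refine (FreeElt.isGLB_iff (P := P)).2 (le_antisymm (α := FreeElt P _) ?_ ?_)
  · exact fun d g s hs => ⟨le_trans hs ((P.re g).monotone (hz.1 (.inl rfl))),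
      le_trans hs ((P.re g).monotone (hz.1 (.inr rfl)))⟩
  · rintro d g s ⟨h₁, h₂⟩
    refine ((hP.re_meets g).2 x y z hz).2 ?_
    rintro _ (rfl | rfl)
    exacts [h₁, h₂]

theorem preservesMeets_freeMult (P : Doctrine.{w, v, u}) (c : P.base) :
    PreservesMeets ((freeMult P).app c) := by
  constructor
  · intro t ht
    exact FreeElt.isTop_iff.2 fun e k y => ⟨e, k, FreeElt.total P e,
      FreeElt.isTop_iff.1 ht _ _ _, 𝟙 e, trivial, Category.id_comp k⟩
  · intro U U' V hV
    obtain rfl := (FreeElt.isGLB_iff (P := free P)).1 hV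
    refine (FreeElt.isGLB_iff (P := P)).2 (le_antisymm (α := FreeElt P _) ?_ ?_)
    · rintro e k y ⟨d, g, S, hS, h⟩
      exact ⟨⟨d, g, S, hS.1, h⟩, ⟨d, g, S, hS.2, h⟩⟩
    -- Members of the two joins may arise from different elements of `U` and `U'`. By down-closure
    -- both can be replaced by the same `(k, ↓y)`, which then lies in the intersection.
    · have key : ∀ (W : FreeElt (free P) c) {e : P.base} (k : e ⟶ c) (y : P.fibre e),
          (freeJoin W).mem k y → W.mem k (FreeElt.principal y : FreeElt P e) := by
        rintro W e k y ⟨d, g, S, hS, m, hm, rfl⟩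
        exact W.down g S m (FreeElt.principal y : FreeElt P e) hS
          ((FreeElt.principal_le_iff y (FreeElt.pull (P := P) m S)).2
            (show S.mem (𝟙 e ≫ m) y by rwa [Category.id_comp]))
      rintro e k y ⟨h, h'⟩
      exact ⟨e, k, FreeElt.principal y, ⟨key U k y h, key U' k y h'⟩, 𝟙 e, (P.re_id y).ge,
        Category.id_comp k⟩

theorem restrictsFree_primDoc : RestrictsFree primDoc.{w, v, u} where
  free_obj hP := hP.free
  free_map f hf _ _ h := ⟨h.1, preservesMeets_freeMap f hf⟩
  free_unit hP := ⟨inferInstanceAs (Limits.PreservesFiniteLimits (𝟭 _)),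
    preservesMeets_freeUnit hP⟩
  free_mult {P} _ := ⟨inferInstanceAs (Limits.PreservesFiniteLimits (𝟭 P.base)),
    preservesMeets_freeMult P⟩
  flat f hP hQ hf := by
    have := hP.finite_limits
    have := hf.1
    exact .of_preservesMeets hP hQ f (IsFlatFunctor.of_preservesFiniteLimits f.functor) hf.2

/-! ### Subdoctrines closed under finite meets -/

namespace Subdoctrine

variable {T : Subdoctrine (free P)}

/-- The fibres of `T` are closed under finite intersections. -/
structure IsMeetClosed (T : Subdoctrine (free P)) : Prop where
  total_mem : ∀ c : P.base, FreeElt.total P c ∈ T.carrier c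
  inter_mem : ∀ (c : P.base) (S S' : FreeElt P c), S ∈ T.carrier c → S' ∈ T.carrier c →
    FreeElt.inter S S' ∈ T.carrier c

namespace IsMeetClosed

variable (hT : T.IsMeetClosed)
include hT

/-- Because `T` contains the greatest element and binary intersections, finite meets in `T` are
computed in `free P`; this and `isGLB_iff` let preservation of meets pass to and from `T`. -/
theorem isTop_iff {c : P.base} {x : T.toDoctrine.fibre c} :
    IsTop x ↔ IsTop (show FreeElt P c from x.1) :=
  ⟨fun h => FreeElt.isTop_iff.2 fun d g y => h ⟨_, hT.total_mem c⟩ g y trivial,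
    fun h y => h y.1⟩

theorem isGLB_iff {c : P.base} {x y z : T.toDoctrine.fibre c} :
    IsGLB {x, y} z ↔ (z.1 : FreeElt P c) = FreeElt.inter (P := P) x.1 y.1 := by
  have hxy : IsGLB {x, y} (⟨_, hT.inter_mem c x.1 y.1 x.2 y.2⟩ : T.toDoctrine.fibre c) := by
    refine ⟨?_, fun V hV d g s hs => ⟨hV (.inl rfl) g s hs, hV (.inr rfl) g s hs⟩⟩
    rintro _ (rfl | rfl) d g s hs
    exacts [hs.1, hs.2]
  constructor
  · intro h
    exact le_antisymm (α := FreeElt P c) (hxy.2 h.1) (h.2 hxy.1)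
  · intro h
    obtain ⟨z, hz⟩ := z
    obtain rfl : z = _ := h
    exact hxy

theorem isPrimary (hP : IsPrimary P) : IsPrimary T.toDoctrine where
  finite_limits := hP.finite_limits
  antisymm c x y h h' := Subtype.ext (le_antisymm (α := FreeElt P c) h h')
  top c := ⟨⟨_, hT.total_mem c⟩, hT.isTop_iff.2 (FreeElt.isTop_iff.2 fun _ _ _ => trivial)⟩
  meet c x y := ⟨⟨_, hT.inter_mem c x.1 y.1 x.2 y.2⟩, hT.isGLB_iff.2 rfl⟩
  re_meets c d f := by
    refine ⟨fun t ht => hT.isTop_iff.2 ((hP.free.re_meets f).1 _ (hT.isTop_iff.1 ht)), ?_⟩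
    intro x y z hz
    refine hT.isGLB_iff.2 ?_
    change FreeElt.pull (P := P) f z.1 = _
    rw [hT.isGLB_iff.1 hz]
    rfl

theorem hom_incl : primDoc.hom T.incl :=
  ⟨inferInstanceAs (Limits.PreservesFiniteLimits (𝟭 P.base)), fun c =>
    ⟨fun _ ht => hT.isTop_iff.1 ht,
      fun x y z hz => (FreeElt.isGLB_iff (P := P)).2 (hT.isGLB_iff.1 hz)⟩⟩

theorem hom_lift (f : Q ⟶ Doctrine.free P) (hf : primDoc.hom f)
    (h : ∀ (c : Q.base) (x : Q.fibre c), f.app c x ∈ T.carrier (f.functor.obj c)) :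
    primDoc.hom (T.lift f h) :=
  ⟨hf.1, fun c => ⟨fun t ht => hT.isTop_iff.2 ((hf.2 c).1 t ht),
    fun x y z hz => hT.isGLB_iff.2 ((FreeElt.isGLB_iff (P := P)).1 ((hf.2 c).2 x y z hz))⟩⟩

end IsMeetClosed

end Subdoctrine

end Doctrine

namespace Doctrine

variable {P Q : Doctrine.{w, v, u}}

/-! ### Subcompletions given by unions of bounded size -/

/-- A class of sets, thought of as those of bounded size, that contains the singletons and is
closed under unions indexed by its members. -/
structure IsSizeClass (Φ : ∀ ⦃α : Type w⦄, Set α → Prop) : Prop where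
  singleton : ∀ {α : Type w} (a : α), Φ {a}
  biUnion : ∀ {α β : Type w} {s : Set α} {f : α → Set β}, Φ s → (∀ a, Φ (f a)) → Φ (⋃ a ∈ s, f a)

/-- The class of singletons. -/
def IsSingleton ⦃α : Type w⦄ (s : Set α) : Prop := ∃ a, s = {a}

theorem isSizeClass_isSingleton : IsSizeClass.{w} IsSingleton where
  singleton a := ⟨a, rfl⟩
  biUnion := by
    rintro α β _ f ⟨a, rfl⟩ hf
    rw [Set.biUnion_singleton]
    exact hf a

theorem isSizeClass_finite : IsSizeClass.{w} fun _ s => s.Finite where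
  singleton a := Set.finite_singleton a
  biUnion hs hf := hs.biUnion fun a _ => hf a

theorem IsSizeClass.image {Φ : ∀ ⦃α : Type w⦄, Set α → Prop} (hΦ : IsSizeClass Φ)
    {α β : Type w} {s : Set α} (hs : Φ s) (f : α → β) : Φ (f '' s) := by
  have := hΦ.biUnion (f := fun a => {f a}) hs fun a => hΦ.singleton (f a)
  rwa [← Set.image_eq_iUnion] at this

/-- The unions of families of elements `∃_f ↓x` whose size is in the class `Φ`. -/
def IsSpan (Φ : ∀ ⦃α : Type (max u v w)⦄, Set α → Prop) {c : P.base} (S : FreeElt P c) : Prop :=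
  ∃ G : Set (ExPair P c), Φ G ∧ S = FreeElt.span G

namespace IsSizeClass

variable {Φ : ∀ ⦃α : Type (max u v w)⦄, Set α → Prop} (hΦ : IsSizeClass Φ)
include hΦ

theorem isSpan_principal {c : P.base} (x : P.fibre c) : IsSpan Φ (FreeElt.principal x) :=
  ⟨_, hΦ.singleton _, FreeElt.principal_eq_span x⟩

/-- Reindexing preserves unions, and Beck–Chevalley turns each generator into a single generator, so
the new family is an image of the old one. -/
theorem isSpan_pull (hP : IsPrimary P) {c d : P.base} (g : d ⟶ c) {S : FreeElt P c}
    (hS : IsSpan Φ S) : IsSpan Φ (FreeElt.pull g S) := by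
  have := hP.finite_limits
  obtain ⟨G, hG, rfl⟩ := hS
  have key (a : ExPair P c) := FreeElt.pull_ex_principal (IsPullback.of_hasPullback g a.arrow) a.elt
  refine ⟨_, hΦ.image hG fun a => ⟨Limits.pullback g a.arrow, Limits.pullback.fst g a.arrow,
    P.re (Limits.pullback.snd g a.arrow) a.elt⟩, le_antisymm ?_ ?_⟩
  · rintro e k y ⟨a, ha, h⟩
    exact ⟨_, ⟨a, ha, rfl⟩, (key a).le k y h⟩
  · rintro e k y ⟨_, ⟨a, ha, rfl⟩, h⟩
    exact ⟨a, ha, (key a).ge k y h⟩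

theorem isSpan_total (hP : IsPrimary P) (c : P.base) : IsSpan Φ (FreeElt.total P c) := by
  obtain ⟨t, ht⟩ := hP.top c
  refine ⟨_, hΦ.singleton ⟨c, 𝟙 c, t⟩, le_antisymm (fun d g x _ => ?_) fun _ _ _ _ => trivial⟩
  exact ⟨_, rfl, g, (hP.re_meets g).1 t ht x, Category.comp_id g⟩

theorem isSpan_inter (hP : IsPrimary P) {c : P.base} {S S' : FreeElt P c} (hS : IsSpan Φ S)
    (hS' : IsSpan Φ S') : IsSpan Φ (FreeElt.inter S S') := by
  have := hP.finite_limits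
  obtain ⟨G, hG, rfl⟩ := hS
  obtain ⟨G', hG', rfl⟩ := hS'
  choose m hm using fun a b : ExPair P c => hP.meet (Limits.pullback a.arrow b.arrow)
    (P.re (Limits.pullback.fst a.arrow b.arrow) a.elt)
    (P.re (Limits.pullback.snd a.arrow b.arrow) b.elt)
  -- Intersection distributes over unions, and `∃_f ↓x ∩ ∃_g ↓y` is again a generator: the diagonal
  -- of the pullback of `f` and `g`, with the meet of the two reindexed elements. The pairs of
  -- generators form a union of images of `G'` indexed by `G`.
  refine ⟨_, hΦ.biUnion hG fun a => hΦ.image hG' fun b => ⟨Limits.pullback a.arrow b.arrow,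
    Limits.pullback.fst a.arrow b.arrow ≫ a.arrow, m a b⟩, le_antisymm ?_ ?_⟩
  · rintro e k y ⟨⟨a, ha, g, hg, rfl⟩, ⟨b, hb, g', hg', hw⟩⟩
    refine ⟨_, Set.mem_biUnion ha ⟨b, hb, rfl⟩, Limits.pullback.lift g g' hw.symm,
      ((hP.re_meets _).2 _ _ _ (hm a b)).2 ?_, by
        rw [← Category.assoc, Limits.pullback.lift_fst]⟩
    rintro _ (rfl | rfl)
    · rw [← re_comp, Limits.pullback.lift_fst]
      exact hg
    · rw [← re_comp, Limits.pullback.lift_snd]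
      exact hg'
  · rintro e k y ⟨_, hc, g, hg, rfl⟩
    obtain ⟨a, ha, b, hb, rfl⟩ := Set.mem_iUnion₂.1 hc
    have hg : y ≤ P.re g (m a b) := hg
    refine ⟨⟨a, ha, g ≫ Limits.pullback.fst _ _, ?_, Category.assoc _ _ _⟩,
      ⟨b, hb, g ≫ Limits.pullback.snd _ _, ?_, ?_⟩⟩
    · change y ≤ P.re _ a.elt
      rw [re_comp]
      exact hg.trans ((P.re g).monotone ((hm a b).1 (.inl rfl)))
    · change y ≤ P.re _ b.elt
      rw [re_comp]
      exact hg.trans ((P.re g).monotone ((hm a b).1 (.inr rfl)))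
    · rw [Category.assoc, ← Limits.pullback.condition]

theorem isSpan_freeApp (f : P ⟶ Q) {c : P.base} {S : FreeElt P c} (hS : IsSpan Φ S) :
    IsSpan Φ (freeApp f S) := by
  obtain ⟨G, hG, rfl⟩ := hS
  exact ⟨_, hΦ.image hG _, FreeElt.freeApp_span f G⟩

/-- A union of unions is flattened: each generator of `U` carries an element of `T` which is itself
such a union, and composing its generators with the arrow of the outer one generates the join. -/
theorem isSpan_freeJoin {c : P.base} {T : Subdoctrine (free P)} {U : FreeElt T.toDoctrine c}
    (hT : ∀ (d : P.base) (S : FreeElt P d), S ∈ T.carrier d → IsSpan Φ S) (hU : IsSpan Φ U) :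
    IsSpan Φ (freeJoin (P := P) (c := c) (freeApp T.incl U)) := by
  obtain ⟨G, hG, rfl⟩ := hU
  choose G' hG' e using fun a : ExPair T.toDoctrine c => hT a.dom a.elt.1 a.elt.2
  refine ⟨_, hΦ.biUnion hG fun a => hΦ.image (hG' a)
    fun b => (⟨b.dom, b.arrow ≫ a.arrow, b.elt⟩ : ExPair P c), le_antisymm ?_ ?_⟩
  · rintro k _ y ⟨d, _, S, ⟨d', _, V, ⟨a, ha, g, hg, rfl⟩, m, hm, rfl⟩, n, hn, rfl⟩
    have h : (a.elt.1 : FreeElt P a.dom).mem ((n ≫ m) ≫ g) y := hg _ _ (hm n y hn)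
    rw [e a] at h
    obtain ⟨b, hb, p, hp, w⟩ := h
    refine ⟨_, Set.mem_biUnion ha ⟨b, hb, rfl⟩, p, hp, ?_⟩
    calc p ≫ b.arrow ≫ a.arrow = (p ≫ b.arrow) ≫ a.arrow := (Category.assoc _ _ _).symm
      _ = ((n ≫ m) ≫ g) ≫ a.arrow := congrArg (· ≫ a.arrow) w
      _ = n ≫ m ≫ g ≫ a.arrow := (Category.assoc (n ≫ m) g a.arrow).trans (Category.assoc n m _)
  · rintro k l y ⟨_, hc, g, hg, rfl⟩
    obtain ⟨a, ha, b, hb, rfl⟩ := Set.mem_iUnion₂.1 hc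
    refine ⟨a.dom, a.arrow, a.elt.1, ⟨a.dom, a.arrow, a.elt,
      ⟨a, ha, 𝟙 _, (T.toDoctrine.re_id (c := a.dom) a.elt).ge, Category.id_comp _⟩, 𝟙 _,
      ((free P).re_id (c := a.dom) a.elt.1).ge, Category.id_comp _⟩, g ≫ b.arrow, ?_,
      Category.assoc _ _ _⟩
    rw [e a]
    exact ⟨b, hb, g, hg, rfl⟩

/-- A family of subdoctrines consisting of the unions of size `Φ` of the elements `∃_f ↓x` is
compatible. -/
theorem isCompatible (T : ∀ P : primDoc.{w, v, u}.Obj, Subdoctrine (free P.of))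
    (hT : ∀ P c, (T P).carrier c = {S | IsSpan Φ (P := P.of) (c := c) S}) :
    IsCompatible restrictsFree_primDoc T := by
  have mem (P : primDoc.{w, v, u}.Obj) (c : P.of.base) (S : FreeElt P.of c) :
      S ∈ (T P).carrier c ↔ IsSpan Φ S := by
    rw [hT]
    rfl
  have closed (P) : (T P).IsMeetClosed :=
    ⟨fun c => (mem P c _).2 (hΦ.isSpan_total P.mem c), fun c S S' hS hS' =>
      (mem P c _).2 (hΦ.isSpan_inter P.mem ((mem P c S).1 hS) ((mem P c S').1 hS'))⟩
  have nat : IsNaturalChoice restrictsFree_primDoc T :=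
    { obj_mem := fun P => (closed P).isPrimary P.mem
      incl_mem := fun P => (closed P).hom_incl
      unit_mem := fun P c x => (mem P c _).2 (hΦ.isSpan_principal x)
      unit_hom := fun P => (closed P).hom_lift _ (restrictsFree_primDoc.unit P).mem _
      map_mem := fun {P Q} f c x =>
        (mem Q _ _).2 (hΦ.isSpan_freeApp f.hom ((mem P c x.1).1 x.2))
      map_hom := fun {P Q} f => (closed Q).hom_lift _
        (primDoc.comp_mem ((closed P).isPrimary P.mem) P.mem.free Q.mem.free (closed P).hom_incl
          (restrictsFree_primDoc.map f).mem) _ }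
  exact
    { toIsNaturalChoice := nat
      mult_mem := fun P c x => (mem P c _).2 (hΦ.isSpan_freeJoin (fun d S => (mem P d S).1)
        ((mem (nat.obj P) c x.1).1 x.2))
      mult_hom := fun P => (closed P).hom_lift _ (nat.preMult P).mem _ }

end IsSizeClass

/-! ### Supercompact and compact elements -/

theorem generate_mem_joinTopology_iff {X : (free P).Total} {R : Presieve X} :
    Sieve.generate R ∈ joinTopology P X ↔ ∀ (d : P.base) (g : d ⟶ X.pt) (x : P.fibre d),
      FreeElt.mem (P := P) X.elt g x → ∃ (Y : (free P).Total) (f : Y ⟶ X), R f ∧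
        (FreeElt.ex (P := P) f.arrow Y.elt).mem g x := by
  refine (isJoinCover_iff _).trans (forall₄_congr fun d g x hx => ⟨?_, ?_⟩)
  · rintro ⟨Y, _, ⟨Z, m, f, hf, rfl⟩, h, hh, rfl⟩
    exact ⟨Z, f, hf, h ≫ m.arrow, m.elt_le h x hh, Category.assoc _ _ _⟩
  · rintro ⟨Y, f, hf, h, hh, rfl⟩
    exact ⟨Y, f, Sieve.le_generate R _ _ hf, h, hh, rfl⟩

/-- The covering family of all arrows with a principal source. -/
def principalPresieve (X : (free P).Total) : Presieve X :=
  fun Y _ => ∃ x : P.fibre Y.pt, Y.elt = (FreeElt.principal x : FreeElt P Y.pt)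

theorem generate_principalPresieve_mem (X : (free P).Total) :
    Sieve.generate (principalPresieve X) ∈ joinTopology P X :=
  generate_mem_joinTopology_iff.2 fun d g x hx => ⟨_, principalHom X g x hx, ⟨x, rfl⟩, 𝟙 d,
    (P.re_id x).ge, Category.id_comp g⟩

theorem ex_le_of_hom {X Y : (free P).Total} (f : Y ⟶ X) :
    FreeElt.ex (P := P) f.arrow Y.elt ≤ (show FreeElt P X.pt from X.elt) :=
  (FreeElt.ex_le_iff (P := P) f.arrow Y.elt X.elt).2 f.elt_le

theorem mem_span_self {c : P.base} {G : Set (ExPair P c)} {a : ExPair P c} (ha : a ∈ G) :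
    (FreeElt.span G).mem a.arrow a.elt :=
  ⟨a, ha, 𝟙 _, (P.re_id _).ge, Category.id_comp _⟩

/-- The elements `∃_f ↓x` are contained in the element `S` as soon as `(f, x) ∈ S`. -/
theorem ex_principal_le {c d : P.base} {S : FreeElt P c} {f : d ⟶ c} {x : P.fibre d}
    (h : S.mem f x) : FreeElt.ex f (FreeElt.principal x) ≤ S := by
  rintro e _ y ⟨g, hg, rfl⟩
  exact S.down f x g y h hg

/-- The cover by principal objects shows a supercompact element to be some `∃_f ↓x`. Conversely, in
any cover of `∃_f ↓x` the arrow that hits the generic member `(f, x)` already covers by itself. -/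
theorem isSupercompact_iff {c : P.base} (S : FreeElt P c) :
    IsSupercompact S ↔ IsSpan IsSingleton S := by
  constructor
  · intro h
    obtain ⟨Y, f, ⟨x, hx⟩, hf⟩ := h _ (generate_principalPresieve_mem _)
    refine ⟨_, ⟨⟨Y.pt, f.arrow, x⟩, rfl⟩, ?_⟩
    rw [FreeElt.span_singleton]
    have e : FreeElt.ex (P := P) f.arrow Y.elt = FreeElt.ex (P := P) f.arrow (FreeElt.principal x) :=
      congrArg _ hx
    refine le_antisymm (fun d g y hy => ?_) (e ▸ ex_le_of_hom f)
    obtain ⟨_, _, ⟨⟩, hm⟩ := generate_mem_joinTopology_iff.1 hf d g y hy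
    exact e ▸ hm
  · rintro ⟨_, ⟨a, rfl⟩, rfl⟩ R hR
    obtain ⟨Y, f, hf, hm⟩ := generate_mem_joinTopology_iff.1 hR _ _ _ (mem_span_self rfl)
    refine ⟨Y, f, hf, generate_mem_joinTopology_iff.2 fun d g y hy => ⟨Y, f, ⟨⟩, ?_⟩⟩
    obtain ⟨_, rfl, h⟩ := hy
    exact ex_principal_le hm g y h

/-- The argument is that of the supercompact case, with one covering arrow chosen for each of
finitely many generators. -/
theorem isCompactElt_iff {c : P.base} (S : FreeElt P c) :
    IsCompactElt S ↔ IsSpan (fun _ s => s.Finite) S := by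
  constructor
  · intro h
    obtain ⟨R, hR, hfin, hc⟩ := h _ (generate_principalPresieve_mem _)
    have hR' (a : {a : Σ Y : (free P).Total, Y ⟶ ⟨c, S⟩ | R a.2}) := hR _ _ a.2
    choose x hx using hR'
    have e (a) : FreeElt.ex (P := P) a.1.2.arrow a.1.1.elt =
        FreeElt.ex (P := P) a.1.2.arrow (FreeElt.principal (x a)) := congrArg _ (hx a)
    have := hfin.to_subtype
    refine ⟨Set.range fun a => ⟨a.1.1.pt, a.1.2.arrow, x a⟩, Set.finite_range _,
      le_antisymm (fun d g y hy => ?_) ?_⟩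
    · obtain ⟨Y, f, hf, hm⟩ := generate_mem_joinTopology_iff.1 hc d g y hy
      exact ⟨_, ⟨⟨⟨Y, f⟩, hf⟩, rfl⟩, (e ⟨⟨Y, f⟩, hf⟩).le g y hm⟩
    · rintro d g y ⟨_, ⟨a, rfl⟩, hm⟩
      exact ex_le_of_hom a.1.2 g y ((e a).ge g y hm)
  · rintro ⟨G, hG, rfl⟩ R hR
    have hR' (a : G) := generate_mem_joinTopology_iff.1 hR _ _ _ (mem_span_self a.2)
    choose Y f hf hm using hR'
    have := hG.to_subtype
    -- The chosen arrows have varying sources; collected in the sigma type they form the range of a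
    -- map from a finite type, whence finiteness of the subfamily.
    let φ (a : G) : Σ Z : (free P).Total, Z ⟶ ⟨c, FreeElt.span G⟩ := ⟨Y a, f a⟩
    let R' : Presieve (⟨c, FreeElt.span G⟩ : (free P).Total) :=
      fun Z k => (⟨Z, k⟩ : Σ Z : (free P).Total, Z ⟶ _) ∈ Set.range φ
    refine ⟨R', ?_, Set.finite_range φ, ?_⟩
    · rintro Z k ⟨a, ha⟩
      obtain ⟨rfl, ha⟩ := Sigma.mk.inj ha
      obtain rfl := eq_of_heq ha
      exact hf a
    · refine generate_mem_joinTopology_iff.2 fun d g y hy => ?_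
      obtain ⟨a, ha, h⟩ := hy
      exact ⟨_, _, ⟨⟨a, ha⟩, rfl⟩, ex_principal_le (hm ⟨a, ha⟩) g y h⟩

/-! ### The existential completion -/

/-- An inclusion out of `∃_f ↓x` is decided at the generic member `(f, x)`, and its membership in
`∃_g ↓y` is precisely a factorisation witnessing the order on pairs. -/
theorem ExPair.le_iff {c : P.base} {a b : ExPair P c} :
    a ≤ b ↔ FreeElt.ex a.arrow (FreeElt.principal a.elt) ≤
      FreeElt.ex b.arrow (FreeElt.principal b.elt) := by
  constructor
  · rintro ⟨h, hw, hx⟩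
    exact ex_principal_le ⟨h, hx, hw⟩
  · intro h
    obtain ⟨g, hg, w⟩ := h a.arrow a.elt ⟨𝟙 _, (P.re_id _).ge, Category.id_comp _⟩
    exact ⟨g, w, hg⟩

/-- By `ExPair.le_iff` the assignment preserves and reflects the order, so it becomes injective on
the poset reflection; it is onto because each element of `T` has a single generator. The reindexing
formula is Beck–Chevalley. -/
theorem isExistentialCompletion (T : Subdoctrine (free P))
    (hT : ∀ c, T.carrier c = {S | IsSpan IsSingleton (P := P) (c := c) S}) :
    IsExistentialCompletion T := by
  have mem {c : P.base} (a : ExPair P c) :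
      FreeElt.ex a.arrow (FreeElt.principal a.elt) ∈ T.carrier c := by
    rw [hT, ← FreeElt.span_singleton]
    exact ⟨_, ⟨a, rfl⟩, rfl⟩
  let F (c : P.base) (a : ExPair P c) : T.toDoctrine.fibre c := ⟨_, mem a⟩
  have hF {c : P.base} {a b : ExPair P c} : a ≤ b ↔ F c a ≤ F c b := ExPair.le_iff
  let e₀ (c : P.base) : Antisymmetrization (ExPair P c) (· ≤ ·) → T.toDoctrine.fibre c :=
    Quotient.lift (F c) fun a b h =>
      Subtype.ext (le_antisymm (α := FreeElt P c) (hF.1 h.1) (hF.1 h.2))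
  have he (c : P.base) (a b : Antisymmetrization (ExPair P c) (· ≤ ·)) :
      e₀ c a ≤ e₀ c b ↔ a ≤ b := by
    induction a using Quotient.inductionOn
    induction b using Quotient.inductionOn
    exact hF.symm
  have bij (c : P.base) : Function.Bijective (e₀ c) := by
    refine ⟨fun a b h => le_antisymm ((he c a b).1 h.le) ((he c b a).1 h.ge), ?_⟩
    rintro ⟨S, hS⟩
    have hS' := hS
    rw [hT] at hS'
    obtain ⟨_, ⟨a, rfl⟩, h⟩ := hS'
    exact ⟨toAntisymmetrization _ a, Subtype.ext (h.trans (FreeElt.span_singleton a)).symm⟩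
  refine ⟨fun c => ⟨Equiv.ofBijective (e₀ c) (bij c), fun {a b} => he c a b⟩, fun _ _ => rfl, ?_⟩
  intro c c' d d' f g k h sq x
  exact Subtype.ext (FreeElt.pull_ex_principal sq x)

/-- The subdoctrine of the unions of size `Φ` of the elements `∃_f ↓x`. -/
def spanSubdoctrine {Φ : ∀ ⦃α : Type (max u v w)⦄, Set α → Prop} (hΦ : IsSizeClass Φ)
    (hP : IsPrimary P) : Subdoctrine (free P) where
  carrier c := {S | IsSpan Φ (P := P) (c := c) S}
  re_mem _ _ f _ hS := hΦ.isSpan_pull hP f hS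

end Doctrine

/-! ### The main theorem -/

theorem corollary7p11 :
    (∀ (A : Sub2Category Doctrine.{w, v, u}) (hA : Doctrine.RestrictsFree A)
      (T : ∀ P : A.Obj, Doctrine.Subdoctrine (Doctrine.free P.of))
      (hT : Doctrine.IsCompatible hA T),
        Doctrine.IsSubGeometric hA.toAdmitsFree hT.monad ∧ hT.monad.IsLaxIdempotent) ∧
    ∃ h : Doctrine.RestrictsFree Doctrine.primDoc.{w, v, u},
      (∃ T : ∀ P : Doctrine.primDoc.{w, v, u}.Obj, Doctrine.Subdoctrine (Doctrine.free P.of),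
        (∀ P c, (T P).carrier c = {S | Doctrine.IsSupercompact (P := P.of) S}) ∧
        Doctrine.IsCompatible h T ∧ ∀ P, Doctrine.IsExistentialCompletion (T P)) ∧
      (∃ T : ∀ P : Doctrine.primDoc.{w, v, u}.Obj, Doctrine.Subdoctrine (Doctrine.free P.of),
        (∀ P c, (T P).carrier c = {S | Doctrine.IsCompactElt (P := P.of) S}) ∧
        Doctrine.IsCompatible h T) :=
  ⟨fun _ _ _ hT => ⟨hT.isSubGeometric, hT.isLaxIdempotent⟩, Doctrine.restrictsFree_primDoc,
    ⟨fun P => Doctrine.spanSubdoctrine Doctrine.isSizeClass_isSingleton P.mem,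
      fun _ _ => Set.ext fun S => (Doctrine.isSupercompact_iff S).symm,
      Doctrine.isSizeClass_isSingleton.isCompatible _ fun _ _ => rfl,
      fun _ => Doctrine.isExistentialCompletion _ fun _ => rfl⟩,
    ⟨fun P => Doctrine.spanSubdoctrine Doctrine.isSizeClass_finite P.mem,
      fun _ _ => Set.ext fun S => (Doctrine.isCompactElt_iff S).symm,
      Doctrine.isSizeClass_finite.isCompatible _ fun _ _ => rfl⟩⟩
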